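/- Let $\mathbb I=[0,1)$. Let $r_0$ be the $1$-periodic function equal to $1$ on $[0,1/2)$ and to $-1$ on $[1/2,1)$, let $r_n(x)=r_0(2^nx)$, and let $w_0=1$ and $w_n=r_{n_1}\cdots r_{n_s}$ for $n=2^{n_1}+\dots+2^{n_s}$ with $n_1>\dots>n_s\ge 0$ (the Walsh functions). For $f\in L_1(\mathbb I^d)$ and $N\in\mathbb N^d$ let $$S_N(f;x)=\sum_{j_1=0}^{N_1-1}\cdots\sum_{j_d=0}^{N_d-1}\hat f(j)\prod_{i=1}^d w_{j_i}(x_i),\qquad \hat f(j)=\int_{\mathbb I^d}f(x)\prod_{i=1}^d w_{j_i}(x_i)\,dx,$$ be the rectangular partial sums of the $d$-dimensional Walsh–Fourier series of $f$. For $B\subset D=\{1,\dots,d\}$, $B'=D\setminus B$, and integers $n_1,\dots,n_d\ge 2$, with $l_n=\sum_{k=1}^{n-1}\frac1k$, let $$(L_{n_B}\circ R_{n_{B'}})(f;x)=\frac{1}{\prod_{i\in D}l_{n_i}}\sum_{k_1=1}^{n_1-1}\cdots\sum_{k_d=1}^{n_d-1}\frac{S_{m(k)}(f;x)}{k_1\cdots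 k_d},\qquad m(k)_i=\begin{cases}n_i-k_i,& i\in B,\\ k_i,& i\in B',\end{cases}$$ be the mixed logarithmic means (Nörlund logarithmic in the variables in $B$, Riesz logarithmic in the others). Let $L\log^\beta L(\mathbb I^d)$ be the Orlicz space of all measurable real functions $f$ on $\mathbb I^d$ with $\int_{\mathbb I^d}Q(|f|/k)\le 1$ for some $k>0$, where $Q(u)=u\log^\beta(1+u)$ (for $\beta=0$ this is $L_1(\mathbb I^d)$). Theorem. There is an absolute constant $C$ such that for every $d$, every $B\subset D$, all integers $n_1,\dots,n_d\ge2$ and every $f\in L\log^{|B|}L(\mathbb I^d)$, $$\left\|(L_{n_B}\circ R_{n_{B'}})(f)\right\|_{L_1(\mathbb I^d)}\le C\left(1+\left\||f|\log^{|B|}|f|\right\|_{L_1(\mathbb I^d)}\right),$$ where $|f|\log^{|B|}|f|$ is read as $0$ where $f=0$, and as $|f|$ if $B=\varnothing$. -/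

import Mathlib

open MeasureTheory
open scoped ENNReal NNReal

namespace WalshLog

/-- The unit cube `[0,1)^d`. -/
def unitCube (d : ℕ) : Set (Fin d → ℝ) := Set.univ.pi fun _ => Set.Ico (0 : ℝ) 1

/-- Lebesgue measure on the unit cube `[0,1)^d`. -/
noncomputable def cubeMeasure (d : ℕ) : Measure (Fin d → ℝ) := volume.restrict (unitCube d)

/-- The Rademacher functions: `r₀` is the `1`-periodic function equal to `1` on `[0,1/2)` and to
`-1` on `[1/2,1)`, and `rₙ(x) = r₀(2ⁿ x)`. -/
noncomputable def rademacher (n : ℕ) (x : ℝ) : ℝ :=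
  if Int.fract (2 ^ n * x) < 1 / 2 then 1 else -1

/-- The Walsh functions in the Paley order: `w_n = r_{n₁} ⋯ r_{n_r}` if
`n = 2^{n₁} + ⋯ + 2^{n_r}` with distinct exponents; `w₀ = 1`. -/
noncomputable def walsh (n : ℕ) (x : ℝ) : ℝ :=
  (n.bitIndices.map fun j => rademacher j x).prod

/-- The `d`-dimensional Walsh functions `∏ᵢ w_{jᵢ}(xᵢ)`. -/
noncomputable def walshProd {d : ℕ} (j : Fin d → ℕ) (x : Fin d → ℝ) : ℝ :=
  ∏ i, walsh (j i) (x i)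

/-- Walsh-Fourier coefficients of `f` on the cube. -/
noncomputable def walshCoeff {d : ℕ} (f : (Fin d → ℝ) → ℝ) (j : Fin d → ℕ) : ℝ :=
  ∫ x, f x * walshProd j x ∂(cubeMeasure d)

/-- Rectangular partial sums: the sum over all `j` with `0 ≤ jᵢ ≤ Nᵢ - 1`. -/
noncomputable def partialSum {d : ℕ} (N : Fin d → ℕ) (f : (Fin d → ℝ) → ℝ) (x : Fin d → ℝ) : ℝ :=
  ∑ j ∈ Fintype.piFinset (fun i => Finset.range (N i)), walshCoeff f j * walshProd j x

/-- `l_n = ∑_{k=1}^{n-1} 1/k`. -/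
noncomputable def logWeight (n : ℕ) : ℝ := ∑ k ∈ Finset.Ico 1 n, 1 / (k : ℝ)

/-- The mixed logarithmic mean, Nörlund logarithmic in the coordinates in `B` and Riesz
logarithmic in the others. The sum runs over all `k` with `1 ≤ kᵢ ≤ nᵢ - 1`, so that the
subtraction `nᵢ - kᵢ` never truncates. -/
noncomputable def mixedLogMean {d : ℕ} (B : Finset (Fin d)) (n : Fin d → ℕ)
    (f : (Fin d → ℝ) → ℝ) (x : Fin d → ℝ) : ℝ :=
  (1 / ∏ i, logWeight (n i)) *
    ∑ k ∈ Fintype.piFinset (fun i => Finset.Ico 1 (n i)),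
      partialSum (fun i => if i ∈ B then n i - k i else k i) f x / ∏ i, (k i : ℝ)

/-- The Luxemburg norm `inf {k > 0 : ∫ Q(|f|/k) ≤ 1}` over the cube, equal to `∞` when there is
no such `k`. -/
noncomputable def luxemburgNorm {d : ℕ} (Q : ℝ → ℝ) (f : (Fin d → ℝ) → ℝ) : ℝ≥0∞ :=
  ⨅ (k : ℝ) (_ : 0 < k ∧ ∫⁻ x, ENNReal.ofReal (Q (|f x| / k)) ∂(cubeMeasure d) ≤ 1),
    ENNReal.ofReal k

/-- Membership in the Orlicz space `L_Q` of the cube. -/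
def MemOrlicz {d : ℕ} (Q : ℝ → ℝ) (f : (Fin d → ℝ) → ℝ) : Prop :=
  AEStronglyMeasurable f (cubeMeasure d) ∧ luxemburgNorm Q f < ∞

/-- The even function `Q(u) = |u| log^β (1 + |u|)`, which generates `L log^β L`; for `β = 0` it is
`|u|`, which generates `L¹`. -/
noncomputable def youngLog (β : ℕ) (u : ℝ) : ℝ := |u| * Real.log (1 + |u|) ^ β

/-- Membership in `L log^β L` of the cube. -/
def MemLLog {d : ℕ} (β : ℕ) (f : (Fin d → ℝ) → ℝ) : Prop := MemOrlicz (youngLog β) f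

end WalshLog

namespace WalshLog

/-! The mean is an integral operator T whose kernel is symmetric and is a product of one-variable
kernels. Writing σ for the sign of Tf, duality gives ‖Tf‖₁ = ∫ f h with h = Tσ, so it suffices to
know how large T can make a function of modulus one. All kernels are constant on dyadic cubes of
side 2⁻ᴺ once every nᵢ ≤ 2ᴺ, so this is a question about finite grids.

In a Riesz variable the kernel is nonnegative with integral one (`riesz_kernel_nonneg`), hence a
contraction on every Lᑫ. In a Nörlund variable the operator is a convex combination of Walsh partial
sums. Up to multiplication by a Walsh function, each of these is a martingale transform with
coefficients 0 and 1, and Burkholder's biconcave function bounds it on L^(2p+2) with constant p + 1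
(`sum_gridSum_pow_le`). These bounds multiply under tensor products, so ‖h‖ in L^(2p+2) is at most
(p+1)^|B| for every p (`sum_mixedKernel_pow_le`).

Such growth is dual to L log^|B| L. A Young-type inequality (`mul_le_young`) bounds |f||h| by
|f||log|f||^|B| plus multiples of powers of h, with coefficients that compensate (p+1)^((2p+2)|B|)
and leave a geometric series independent of |B| and d (`exists_lintegral_mul_le`). This is why C is
absolute. -/

/-! ### Nonnegativity of the Riesz logarithmic kernel -/

/-- The Walsh product `∏ εᵢ` over the binary digits of `n`, for an arbitrary sequence `ε`. -/
noncomputable def digitProd (ε : ℕ → ℝ) (n : ℕ) : ℝ := (n.bitIndices.map ε).prod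

theorem digitProd_zero (ε : ℕ → ℝ) : digitProd ε 0 = 1 := by simp [digitProd]

theorem digitProd_two_mul (ε : ℕ → ℝ) (n : ℕ) :
    digitProd ε (2 * n) = digitProd (fun i => ε (i + 1)) n := by
  simp [digitProd, Nat.bitIndices_two_mul, Function.comp_def]

theorem digitProd_two_mul_add_one (ε : ℕ → ℝ) (n : ℕ) :
    digitProd ε (2 * n + 1) = ε 0 * digitProd (fun i => ε (i + 1)) n := by
  simp [digitProd, Nat.bitIndices_two_mul_add_one, Function.comp_def]

theorem digitProd_mul (ε δ : ℕ → ℝ) (n : ℕ) :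
    digitProd (fun i => ε i * δ i) n = digitProd ε n * digitProd δ n := by
  simp [digitProd, List.prod_map_mul]

theorem digitProd_eq_or (ε : ℕ → ℝ) (hε : ∀ i, ε i = 1 ∨ ε i = -1) (n : ℕ) :
    digitProd ε n = 1 ∨ digitProd ε n = -1 := by
  unfold digitProd
  induction n.bitIndices with
  | nil => simp
  | cons a l ih =>
    rcases hε a with h | h <;> rcases ih with h' | h' <;> simp [h, h']

/-- Digits below position s carry the factor 1, so the product is constant on blocks of length 2^s.
-/
theorem digitProd_pow_mul_add (s : ℕ) : ∀ (ε : ℕ → ℝ), (∀ i < s, ε i = 1) → ∀ q p : ℕ,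
    p < 2 ^ s → digitProd ε (2 ^ s * q + p) = digitProd (fun i => ε (i + s)) q := by
  induction s with
  | zero => intro ε _ q p hp; simp at hp; simp [hp]
  | succ s ih =>
    intro ε h q p hp
    have key := ih (fun i => ε (i + 1)) (fun i hi => h _ (by omega)) q (p / 2)
      (by rw [pow_succ] at hp; omega)
    have e0 := h 0 (by omega)
    have e2 : (fun i => ε (i + (s + 1))) = fun i => ε (i + s + 1) := by
      funext i; rfl
    rw [e2, ← key]
    rcases Nat.mod_two_eq_zero_or_one p with h0 | h0
    · have : 2 ^ (s + 1) * q + p = 2 * (2 ^ s * q + p / 2) := by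
        rw [pow_succ, mul_add, show 2 * (p / 2) = p by omega]; ring
      rw [this, digitProd_two_mul]
    · have : 2 ^ (s + 1) * q + p = 2 * (2 ^ s * q + p / 2) + 1 := by
        rw [pow_succ, mul_add, add_assoc, show 2 * (p / 2) + 1 = p by omega]; ring
      rw [this, digitProd_two_mul_add_one, e0, one_mul]

theorem sum_range_mul {M : Type*} [AddCommMonoid M] (f : ℕ → M) (a b : ℕ) :
    ∑ k ∈ Finset.range (a * b), f k
      = ∑ l ∈ Finset.range b, ∑ r ∈ Finset.range a, f (a * l + r) := by
  induction b with
  | zero => simp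
  | succ b ih => rw [Nat.mul_succ, Finset.sum_range_add, ih, Finset.sum_range_succ]

/-- Two consecutive blocks of length 2^s carry opposite signs, so the Dirichlet kernel rises by 2^s,
falls back to 0, and repeats with the sign given by the higher digits: a signed tent on each
interval of length 2·2^s. -/
theorem sum_digitProd_eq (ε : ℕ → ℝ) (s : ℕ) (h1 : ∀ i < s, ε i = 1) (hs : ε s = -1)
    (l : ℕ) : ∀ r ≤ 2 * 2 ^ s, ∑ j ∈ Finset.range (2 * 2 ^ s * l + r), digitProd ε j
      = digitProd (fun i => ε (i + (s + 1))) l * ((min r (2 * 2 ^ s - r) : ℕ) : ℝ) := by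
  have step : ∀ l, ∑ j ∈ Finset.range (2 * 2 ^ s * l), digitProd ε j = 0 →
      ∀ r ≤ 2 * 2 ^ s, ∑ j ∈ Finset.range (2 * 2 ^ s * l + r), digitProd ε j
      = digitProd (fun i => ε (i + (s + 1))) l * ((min r (2 * 2 ^ s - r) : ℕ) : ℝ) := by
    intro l hl r
    have eshift : (fun i => ε (i + (s + 1))) = fun i => ε (i + 1 + s) := by
      funext i; congr 1; ring
    induction r with
    | zero => intro _; simp [hl]
    | succ r ih =>
      intro hr
      rw [← add_assoc, Finset.sum_range_succ, ih (by omega)]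
      by_cases hrs : r < 2 ^ s
      · have : 2 * 2 ^ s * l + r = 2 ^ s * (2 * l) + r := by ring
        rw [this, digitProd_pow_mul_add s ε h1 _ _ hrs, digitProd_two_mul, ← eshift,
          min_eq_left (by omega), min_eq_left (by omega)]
        push_cast; ring
      · have : 2 * 2 ^ s * l + r = 2 ^ s * (2 * l + 1) + (r - 2 ^ s) := by
          rw [mul_add, mul_one, add_assoc, Nat.add_sub_cancel' (by omega)]; ring
        rw [this, digitProd_pow_mul_add s ε h1 _ _ (by omega), digitProd_two_mul_add_one,
          ← eshift, min_eq_right (by omega), min_eq_right (by omega), Nat.cast_sub (by omega),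
          Nat.cast_sub (by omega)]
        simp only [zero_add, hs]
        push_cast; ring
  have hz : ∀ l, ∑ j ∈ Finset.range (2 * 2 ^ s * l), digitProd ε j = 0 := by
    intro l
    induction l with
    | zero => simp
    | succ l ih => rw [Nat.mul_succ, step l ih _ le_rfl]; simp
  exact step l (hz l)

/-- Grouping into blocks of length 2^t with sums A turns the sum into a signed sum of the gaps A(2i)
- A(2i+1). The gap i = 0 has sign +, and since A decreases the others total at most A 2, so A 1 + A
2 ≤ A 0 suffices. -/
theorem sum_digitProd_mul_nonneg (ε : ℕ → ℝ) (hε : ∀ i, ε i = 1 ∨ ε i = -1) (t : ℕ)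
    (h1 : ∀ i < t, ε i = 1) (ht : ε t = -1) (a : ℕ → ℝ) (ha : Antitone a) (h0 : ∀ l, 0 ≤ a l)
    (hdom : ∑ r ∈ Finset.range (2 ^ t), a (2 ^ t * 1 + r)
      + ∑ r ∈ Finset.range (2 ^ t), a (2 ^ t * 2 + r)
      ≤ ∑ r ∈ Finset.range (2 ^ t), a (2 ^ t * 0 + r)) (R : ℕ) :
    0 ≤ ∑ l ∈ Finset.range (2 ^ t * (2 * R)), digitProd ε l * a l := by
  set A : ℕ → ℝ := fun i => ∑ r ∈ Finset.range (2 ^ t), a (2 ^ t * i + r) with hA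
  have hAanti : Antitone A := fun i j hij => by
    refine Finset.sum_le_sum fun r _ => ha ?_
    gcongr
  have hA0 : ∀ i, 0 ≤ A i := fun i => Finset.sum_nonneg fun r _ => h0 _
  have hblock : ∑ l ∈ Finset.range (2 ^ t * (2 * R)), digitProd ε l * a l
      = ∑ i ∈ Finset.range R, digitProd (fun i => ε (i + 1 + t)) i
        * (A (2 * i) - A (2 * i + 1)) := by
    rw [sum_range_mul, sum_range_mul]
    refine Finset.sum_congr rfl fun i _ => ?_
    have : ∀ q, ∑ r ∈ Finset.range (2 ^ t), digitProd ε (2 ^ t * q + r) * a (2 ^ t * q + r)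
        = digitProd (fun i => ε (i + t)) q * A q := by
      intro q
      rw [hA, Finset.mul_sum]
      refine Finset.sum_congr rfl fun r hr => ?_
      rw [digitProd_pow_mul_add t ε h1 _ _ (Finset.mem_range.1 hr)]
    simp only [this, Finset.sum_range_succ, Finset.sum_range_zero, zero_add, add_zero,
      digitProd_two_mul, digitProd_two_mul_add_one, ht]
    ring
  rw [hblock]
  cases R with
  | zero => simp
  | succ R =>
    rw [Finset.sum_range_succ', digitProd_zero, one_mul]
    have htail : ∀ R, ∑ i ∈ Finset.range R, (A (2 * (i + 1)) - A (2 * (i + 1) + 1))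
        ≤ A 2 - A (2 * R + 2) := by
      intro R
      induction R with
      | zero => simp
      | succ R ih =>
        rw [Finset.sum_range_succ]
        have := hAanti (show 2 * (R + 1) + 1 ≤ 2 * (R + 1) + 2 by omega)
        have e : A (2 * (R + 1)) = A (2 * R + 2) := by congr 1
        linarith
    have hlow : -∑ i ∈ Finset.range R, (A (2 * (i + 1)) - A (2 * (i + 1) + 1))
        ≤ ∑ i ∈ Finset.range R, digitProd (fun i => ε (i + 1 + t)) (i + 1)
          * (A (2 * (i + 1)) - A (2 * (i + 1) + 1)) := by
      rw [← Finset.sum_neg_distrib]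
      refine Finset.sum_le_sum fun i _ => ?_
      have := hAanti (show 2 * (i + 1) ≤ 2 * (i + 1) + 1 by omega)
      rcases digitProd_eq_or (fun i => ε (i + 1 + t)) (fun i => hε _) (i + 1) with h | h <;>
        rw [h] <;> linarith
    have := htail R
    have := hA0 (2 * R + 2)
    simp only [mul_zero, zero_add]
    linarith [show A 1 + A 2 ≤ A 0 from hdom]

theorem sum_min_range (P : ℕ) :
    ∑ r ∈ Finset.range (2 * P), ((min r (2 * P - r) : ℕ) : ℝ) = P * P := by
  rw [two_mul, Finset.sum_range_add, ← Finset.sum_add_distrib]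
  have : ∀ r ∈ Finset.range P, ((min r (P + P - r) : ℕ) : ℝ)
      + ((min (P + r) (P + P - (P + r)) : ℕ) : ℝ) = P := by
    intro r hr
    rw [Finset.mem_range] at hr
    rw [← Nat.cast_add]
    congr 1
    omega
  rw [Finset.sum_congr rfl this, Finset.sum_const, Finset.card_range, nsmul_eq_mul]

/-- The Riesz logarithmic kernel for the Walsh system is nonnegative. -/
theorem riesz_kernel_nonneg (ε : ℕ → ℝ) (hε : ∀ i, ε i = 1 ∨ ε i = -1) (n : ℕ) :
    0 ≤ ∑ k ∈ Finset.Ico 1 n, (∑ j ∈ Finset.range k, digitProd ε j) / (k : ℝ) := by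
  by_cases hex : ∃ s, ε s = -1
  swap
  · push Not at hex
    have h1 : ∀ i, ε i = 1 := fun i => (hε i).resolve_right (hex i)
    have h2 : ∀ j, 0 ≤ digitProd ε j := fun j => by
      rw [funext h1]
      simp [digitProd]
    exact Finset.sum_nonneg fun k _ =>
      div_nonneg (Finset.sum_nonneg fun j _ => h2 j) (Nat.cast_nonneg k)
  classical
  obtain ⟨s, hs, hmin⟩ : ∃ s, ε s = -1 ∧ ∀ i < s, ε i = 1 :=
    ⟨Nat.find hex, Nat.find_spec hex, fun i hi => (hε i).resolve_right (Nat.find_min hex hi)⟩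
  set P : ℕ := 2 ^ s with hP
  have hPpos : 0 < P := by positivity
  -- The truncated weight 1/k. Since 1/0 = 0 here, it decreases only from k = 1 on; the tent
  -- vanishes at r = 0, so this does not disturb the monotonicity of `T`.
  set c : ℕ → ℝ := fun k => if k < n then 1 / (k : ℝ) else 0 with hc
  have hc0 : ∀ k, 0 ≤ c k := fun k => by simp only [hc]; split_ifs <;> positivity
  have hcle : ∀ k, c k ≤ 1 / (k : ℝ) := fun k => by
    simp only [hc]; split_ifs; exacts [le_rfl, by positivity]
  have hcanti : ∀ i j, 1 ≤ i → i ≤ j → c j ≤ c i := fun i j hi hij => by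
    simp only [hc]
    by_cases hj : j < n
    · rw [if_pos hj, if_pos (by omega)]
      have : (0 : ℝ) < i := by exact_mod_cast hi
      gcongr
    · rw [if_neg hj]; exact hc0 i
  set T : ℕ → ℝ := fun l => ∑ r ∈ Finset.range (2 * P),
    ((min r (2 * P - r) : ℕ) : ℝ) * c (2 * P * l + r) with hT
  have hT0 : ∀ l, 0 ≤ T l := fun l => Finset.sum_nonneg fun r _ => mul_nonneg (by positivity) (hc0 _)
  have hTanti : Antitone T := fun l l' hl => by
    refine Finset.sum_le_sum fun r _ => ?_
    rcases Nat.eq_zero_or_pos r with h | h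
    · simp [h]
    · refine mul_le_mul_of_nonneg_left (hcanti _ _ (by omega) ?_) (by positivity)
      gcongr
  set ε' : ℕ → ℝ := fun i => ε (i + (s + 1)) with hε'
  have hsum : ∀ Q, n ≤ Q → ∑ k ∈ Finset.Ico 1 n, (∑ j ∈ Finset.range k, digitProd ε j) / (k : ℝ)
      = ∑ l ∈ Finset.range Q, digitProd ε' l * T l := by
    intro Q hQ
    have h1 : ∑ k ∈ Finset.Ico 1 n, (∑ j ∈ Finset.range k, digitProd ε j) / (k : ℝ)
        = ∑ k ∈ Finset.range (2 * P * Q), (∑ j ∈ Finset.range k, digitProd ε j) * c k := by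
      have hsub : Finset.Ico 1 n ⊆ Finset.range (2 * P * Q) := fun k hk => by
        rw [Finset.mem_Ico] at hk
        rw [Finset.mem_range]
        nlinarith
      rw [← Finset.sum_subset hsub]
      · refine Finset.sum_congr rfl fun k hk => ?_
        rw [Finset.mem_Ico] at hk
        simp [hc, hk.2, div_eq_mul_inv]
      · intro k _ hk
        rw [Finset.mem_Ico] at hk
        rcases Nat.eq_zero_or_pos k with h | h
        · simp [h]
        · simp [hc, show ¬ k < n by omega]
    rw [h1, sum_range_mul]
    refine Finset.sum_congr rfl fun l _ => ?_
    rw [hT, Finset.mul_sum]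
    refine Finset.sum_congr rfl fun r hr => ?_
    rw [sum_digitProd_eq ε s hmin hs l r (Finset.mem_range.1 hr).le]
    ring
  by_cases hex' : ∃ t, ε' t = -1
  swap
  · push Not at hex'
    have h1 : ∀ i, ε' i = 1 := fun i => (hε _).resolve_right (hex' i)
    have h2 : ∀ j, 0 ≤ digitProd ε' j := fun j => by
      rw [funext h1]
      simp [digitProd]
    rw [hsum n le_rfl]
    exact Finset.sum_nonneg fun l _ => mul_nonneg (h2 l) (hT0 l)
  obtain ⟨t, ht, htmin⟩ : ∃ t, ε' t = -1 ∧ ∀ i < t, ε' i = 1 :=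
    ⟨Nat.find hex', Nat.find_spec hex',
      fun i hi => (hε _).resolve_right (Nat.find_min hex' hi)⟩
  have htpos : 0 < 2 ^ t := by positivity
  rw [hsum (2 ^ t * (2 * n)) (by nlinarith)]
  refine sum_digitProd_mul_nonneg ε' (fun i => hε _) t htmin ht T hTanti hT0 ?_ n
  have hle0 : T 0 ≤ ∑ r ∈ Finset.range (2 ^ t), T (2 ^ t * 0 + r) := by
    rw [mul_zero]
    simp only [zero_add]
    exact Finset.single_le_sum (f := T) (fun i _ => hT0 i) (Finset.mem_range.2 htpos)
  refine le_trans ?_ hle0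
  have hPR : (0 : ℝ) < P := by exact_mod_cast hPpos
  -- If n ≤ 2P, only the tent l = 0 meets the truncation. Otherwise the first tent alone gives at
  -- least P, while the next two groups of 2^t tents give at most P/2 and P/4.
  by_cases hn : n ≤ 2 * P
  · have : ∀ l, 1 ≤ l → T l = 0 := fun l hl => by
      refine Finset.sum_eq_zero fun r _ => ?_
      simp [hc, show ¬ (2 * P * l + r < n) by nlinarith]
    rw [Finset.sum_eq_zero fun r _ => this _ (by omega),
      Finset.sum_eq_zero fun r _ => this _ (by omega)]
    simpa using hT0 0
  · have hTle : ∀ m l, 0 < m → m ≤ l → T l ≤ P / (2 * m) := fun m l hm hml => by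
      have hmR : (0 : ℝ) < m := by exact_mod_cast hm
      calc T l ≤ ∑ r ∈ Finset.range (2 * P), ((min r (2 * P - r) : ℕ) : ℝ) * (1 / (2 * P * m)) := by
            refine Finset.sum_le_sum fun r _ => mul_le_mul_of_nonneg_left ?_ (by positivity)
            refine (hcle _).trans ?_
            have : (m : ℝ) ≤ l := by exact_mod_cast hml
            push_cast
            apply one_div_le_one_div_of_le (by positivity)
            have : (2 : ℝ) * P * m ≤ 2 * P * l := by gcongr
            have : (0 : ℝ) ≤ r := by positivity
            linarith
        _ = P / (2 * m) := by
            rw [← Finset.sum_mul, sum_min_range]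
            field_simp
    have htR : (0 : ℝ) < 2 ^ t := by positivity
    have b1 : ∑ r ∈ Finset.range (2 ^ t), T (2 ^ t * 1 + r) ≤ P / 2 := by
      refine (Finset.sum_le_sum fun r _ => hTle (2 ^ t) _ htpos (by omega)).trans ?_
      simp
      field_simp
      exact le_rfl
    have b2 : ∑ r ∈ Finset.range (2 ^ t), T (2 ^ t * 2 + r) ≤ P / 4 := by
      refine (Finset.sum_le_sum fun r _ => hTle (2 ^ t * 2) _ (by omega) (by omega)).trans ?_
      simp
      field_simp
      norm_num
    -- On its rising side the tent has height r, which cancels the weight 1/r: the terms r = 1, …, P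
    -- contribute 1 each.
    have b0 : (P : ℝ) ≤ T 0 := by
      rw [hT]
      simp only [mul_zero, zero_add]
      have hsub : Finset.range (P + 1) ⊆ Finset.range (2 * P) :=
        Finset.range_subset_range.2 (by omega)
      refine le_trans ?_ (Finset.sum_le_sum_of_subset_of_nonneg hsub
        fun r _ _ => mul_nonneg (by positivity) (hc0 _))
      have hone : ∀ r ∈ Finset.range P,
          ((min (r + 1) (2 * P - (r + 1)) : ℕ) : ℝ) * c (r + 1) = 1 := by
        intro r hr
        rw [Finset.mem_range] at hr
        have hlt : r + 1 < n := by omega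
        have : ((r + 1 : ℕ) : ℝ) ≠ 0 := by positivity
        simp only [hc, if_pos hlt]
        rw [min_eq_left (by omega)]
        field_simp
      rw [Finset.sum_range_succ', Finset.sum_congr rfl hone]
      simp
    linarith

/-! ### Biconcavity and majorization for Burkholder's function -/

/-- A is convex and nondecreasing on [1, ∞), so freezing it at its value at 1 to the left of 1 keeps
it convex. -/
theorem two_mul_comp_max_le {A A' : ℝ → ℝ} (hd : ∀ x, HasDerivAt A (A' x) x)
    (hmono : MonotoneOn A' (Set.Ici 1)) (h0 : 0 ≤ A' 1) (x t : ℝ) :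
    2 * A (max x 1) ≤ A (max (x + t) 1) + A (max (x - t) 1) := by
  have hA : deriv A = A' := funext fun x => (hd x).deriv
  have hcont : Continuous A := continuous_iff_continuousAt.2 fun x => (hd x).continuousAt
  have hdiff : Differentiable ℝ A := fun x => (hd x).differentiableAt
  have hconv : ConvexOn ℝ (Set.Ici 1) A := by
    refine MonotoneOn.convexOn_of_deriv (convex_Ici 1) hcont.continuousOn
      hdiff.differentiableOn ?_
    rw [hA]
    exact hmono.mono interior_subset
  have hAmono : MonotoneOn A (Set.Ici 1) := by
    refine monotoneOn_of_deriv_nonneg (convex_Ici 1) hcont.continuousOn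
      hdiff.differentiableOn fun x hx => ?_
    rw [hA]
    have hx' : (1 : ℝ) ≤ x := interior_subset hx
    exact h0.trans (hmono (Set.mem_Ici.2 le_rfl) hx' hx')
  have h1 : (1 : ℝ) ≤ max (x + t) 1 := le_max_right _ _
  have h2 : (1 : ℝ) ≤ max (x - t) 1 := le_max_right _ _
  have h3 : max x 1 ≤ (1 / 2 : ℝ) * max (x + t) 1 + (1 / 2 : ℝ) * max (x - t) 1 := by
    refine max_le ?_ (by linarith)
    linarith [le_max_left (x + t) 1, le_max_left (x - t) 1]
  have h4 := hAmono (Set.mem_Ici.2 (le_max_right x 1))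
    (Set.mem_Ici.2 ((le_max_right x 1).trans h3)) h3
  have h5 := hconv.2 h1 h2 (show (0 : ℝ) ≤ 1 / 2 by norm_num)
    (show (0 : ℝ) ≤ 1 / 2 by norm_num) (by norm_num)
  simp only [smul_eq_mul] at h5
  linarith

/-- A, and B in the next lemma, measure how far `burkholder p · (-1)` falls below its middle affine
piece to the right of 1 and to the left of -1. Both vanish at 1. -/
theorem two_mul_pow_sub_comp_max_le (p : ℕ) (x t : ℝ) :
    let A : ℝ → ℝ := fun x => p * x ^ (2 * p + 2) - (p + 1) * x ^ (2 * p + 1) + (p + 1) * x - p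
    2 * A (max x 1) ≤ A (max (x + t) 1) + A (max (x - t) 1) := by
  intro A
  refine two_mul_comp_max_le (A' := fun x => (p + 1) *
    (2 * p * x ^ (2 * p + 1) - (2 * p + 1) * x ^ (2 * p) + 1)) (fun x => ?_) ?_ ?_ x t
  · have h := ((((hasDerivAt_pow (2 * p + 2) x).const_mul (p : ℝ)).sub
      ((hasDerivAt_pow (2 * p + 1) x).const_mul ((p : ℝ) + 1))).add
      ((hasDerivAt_id x).const_mul ((p : ℝ) + 1))).sub_const (p : ℝ)
    refine h.congr_deriv ?_
    push_cast
    ring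
  · have hd : ∀ x : ℝ, HasDerivAt (fun x : ℝ => (p + 1) *
        (2 * p * x ^ (2 * p + 1) - (2 * p + 1) * x ^ (2 * p) + 1))
        ((p + 1) * (2 * p * (2 * p + 1)) * (x ^ (2 * p) - x ^ (2 * p - 1))) x := fun x => by
      have h := ((((hasDerivAt_pow (2 * p + 1) x).const_mul (2 * p : ℝ)).sub
        ((hasDerivAt_pow (2 * p) x).const_mul (2 * (p : ℝ) + 1))).add_const 1).const_mul
        ((p : ℝ) + 1)
      refine h.congr_deriv ?_
      push_cast
      ring
    refine monotoneOn_of_deriv_nonneg (convex_Ici 1)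
      (continuous_iff_continuousAt.2 fun x => (hd x).continuousAt).continuousOn
      (fun x _ => (hd x).differentiableAt.differentiableWithinAt) fun x hx => ?_
    rw [(hd x).deriv]
    have hx' : (1 : ℝ) ≤ x := interior_subset hx
    have := pow_le_pow_right₀ hx' (show 2 * p - 1 ≤ 2 * p by omega)
    exact mul_nonneg (by positivity) (by linarith)
  · simp

theorem two_mul_pow_add_comp_max_le (p : ℕ) (x t : ℝ) :
    let B : ℝ → ℝ := fun x => p * x ^ (2 * p + 2) + (p + 1) * x ^ (2 * p + 1) - (p + 1) * x - p
    2 * B (max x 1) ≤ B (max (x + t) 1) + B (max (x - t) 1) := by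
  intro B
  refine two_mul_comp_max_le (A' := fun x => (p + 1) *
    (2 * p * x ^ (2 * p + 1) + (2 * p + 1) * x ^ (2 * p) - 1)) (fun x => ?_) ?_ ?_ x t
  · have h := ((((hasDerivAt_pow (2 * p + 2) x).const_mul (p : ℝ)).add
      ((hasDerivAt_pow (2 * p + 1) x).const_mul ((p : ℝ) + 1))).sub
      ((hasDerivAt_id x).const_mul ((p : ℝ) + 1))).sub_const (p : ℝ)
    refine h.congr_deriv ?_
    push_cast
    ring
  · intro x hx y _ hxy
    have hx0 : (0 : ℝ) ≤ x := zero_le_one.trans hx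
    simp only
    gcongr
  · simp only [one_pow, mul_one]
    exact mul_nonneg (by positivity) (by linarith [Nat.cast_nonneg (α := ℝ) p])

/-- Burkholder's function for the exponent `2 * p + 2`, in the variables `z = (x + y) / 2` and
`w = (x - y) / 2`, in which it is biconcave. -/
noncomputable def burkholder (p : ℕ) (z w : ℝ) : ℝ :=
  if |w| ≤ |z| then -(z ^ (2 * p + 1) * (p * z + (p + 1) * w))
  else -(w ^ (2 * p + 1) * (p * w + (p + 1) * z))

theorem burkholder_comm (p : ℕ) (z w : ℝ) : burkholder p z w = burkholder p w z := by
  unfold burkholder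
  rcases lt_trichotomy |w| |z| with h | h | h
  · rw [if_pos h.le, if_neg (not_le.2 h)]
  · rw [if_pos h.le, if_pos h.ge]
    rcases abs_eq_abs.1 h with h' | h'
    · rw [h']
    · rw [h', Odd.neg_pow ⟨p, rfl⟩]; ring
  · rw [if_neg (not_le.2 h), if_pos h.le]

theorem burkholder_mul (p : ℕ) (c z w : ℝ) :
    burkholder p (c * z) (c * w) = c ^ (2 * p + 2) * burkholder p z w := by
  rcases eq_or_ne c 0 with rfl | hc
  · simp [burkholder]
  have hc' : 0 < |c| := abs_pos.2 hc
  unfold burkholder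
  simp only [abs_mul, mul_le_mul_iff_right₀ hc']
  split_ifs <;> ring

theorem burkholder_zero_right_nonpos (p : ℕ) (z : ℝ) : burkholder p z 0 ≤ 0 := by
  have : 0 ≤ (p : ℝ) * (z ^ (p + 1)) ^ 2 := by positivity
  simp only [burkholder, abs_zero, abs_nonneg, if_true]
  calc _ = -((p : ℝ) * (z ^ (p + 1)) ^ 2) := by ring
    _ ≤ 0 := by linarith

/-- An affine function minus two convex corrections, one for each outer region: this form makes
concavity in x visible without a case split on the three points of a midpoint inequality. -/
theorem burkholder_neg_one (p : ℕ) (x : ℝ) :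
    burkholder p x (-1) = (p + 1) * x - p
      - (p * max x 1 ^ (2 * p + 2) - (p + 1) * max x 1 ^ (2 * p + 1) + (p + 1) * max x 1 - p)
      - (p * max (-x) 1 ^ (2 * p + 2) + (p + 1) * max (-x) 1 ^ (2 * p + 1)
        - (p + 1) * max (-x) 1 - p) := by
  unfold burkholder
  simp only [abs_neg, abs_one]
  by_cases h : 1 ≤ |x|
  · rw [if_pos h]
    rcases le_abs.1 h with h' | h'
    · rw [max_eq_left h', max_eq_right (by linarith : -x ≤ 1)]
      simp only [one_pow]; ring
    · rw [max_eq_left h', max_eq_right (by linarith : x ≤ 1), Odd.neg_pow ⟨p, rfl⟩,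
        Even.neg_pow ⟨p + 1, by ring⟩]
      simp only [one_pow]; ring
  · rw [if_neg h]
    have h1 := (abs_lt.1 (not_le.1 h))
    rw [max_eq_right (by linarith : x ≤ 1), max_eq_right (by linarith : -x ≤ 1),
      Odd.neg_pow ⟨p, rfl⟩]
    simp only [one_pow]; ring

/-- By homogeneity of even degree, w ≠ 0 can be scaled to -1; for w = 0 the function is a
nonpositive multiple of an even power. -/
theorem burkholder_midpoint_left (p : ℕ) (z w t : ℝ) :
    burkholder p (z + t) w + burkholder p (z - t) w ≤ 2 * burkholder p z w := by
  rcases eq_or_ne w 0 with rfl | hw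
  · simp only [burkholder, abs_zero, abs_nonneg, if_true, mul_zero, add_zero]
    have hc := ((even_two_mul (p + 1)).convexOn_pow (𝕜 := ℝ)).2 (Set.mem_univ (z + t))
      (Set.mem_univ (z - t)) (show (0 : ℝ) ≤ 1 / 2 by norm_num)
      (show (0 : ℝ) ≤ 1 / 2 by norm_num) (by norm_num)
    simp only [smul_eq_mul] at hc
    rw [show (1 / 2 : ℝ) * (z + t) + 1 / 2 * (z - t) = z by ring] at hc
    have e : ∀ y : ℝ, -(y ^ (2 * p + 1) * (p * y)) = -(p * y ^ (2 * (p + 1))) := fun y => by ring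
    simp only [e]
    have := mul_le_mul_of_nonneg_left hc (Nat.cast_nonneg (α := ℝ) p)
    linarith
  · have key : ∀ x, burkholder p x w = w ^ (2 * p + 2) * burkholder p (-x / w) (-1) := fun x => by
      rw [show w ^ (2 * p + 2) = (-w) ^ (2 * p + 2) from
        (Even.neg_pow ⟨p + 1, by ring⟩ w).symm, ← burkholder_mul]
      congr 1
      · field_simp
      · ring
    rw [key, key, key, ← mul_add, mul_left_comm]
    refine mul_le_mul_of_nonneg_left ?_ (Even.pow_nonneg ⟨p + 1, by ring⟩ w)
    rw [show -(z + t) / w = -z / w + -t / w by ring, show -(z - t) / w = -z / w - -t / w by ring]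
    set x := -z / w
    set s := -t / w
    simp only [burkholder_neg_one]
    have h1 := two_mul_pow_sub_comp_max_le p x s
    have h2 := two_mul_pow_add_comp_max_le p (-x) s
    simp only at h1 h2
    rw [show -x + s = -(x - s) by ring, show -x - s = -(x + s) by ring] at h2
    linarith

theorem burkholder_midpoint_right (p : ℕ) (z w t : ℝ) :
    burkholder p z (w + t) + burkholder p z (w - t) ≤ 2 * burkholder p z w := by
  rw [burkholder_comm p z, burkholder_comm p z, burkholder_comm p z]
  exact burkholder_midpoint_left p w z t

/-- Bernoulli's inequality for ((p+1)(1+s))^(2p+2) with s = w/z when |w| ≤ |z|; the other case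
follows by symmetry. -/
theorem pow_sub_le_burkholder (p : ℕ) (z w : ℝ) :
    z ^ (2 * p + 2) - (p + 1) ^ (2 * p + 2) * (z + w) ^ (2 * p + 2)
      ≤ (2 * p + 2) * burkholder p z w := by
  have key : ∀ z w : ℝ, |w| ≤ |z| →
      z ^ (2 * p + 2) - (p + 1) ^ (2 * p + 2) * (z + w) ^ (2 * p + 2)
      ≤ (2 * p + 2) * burkholder p z w := by
    intro z w h
    rcases eq_or_ne z 0 with rfl | hz
    · have : w = 0 := by simpa using h
      simp [burkholder, this]
    obtain ⟨s, rfl⟩ : ∃ s, w = z * s := ⟨w / z, by field_simp⟩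
    have hz' : 0 < |z| := abs_pos.2 hz
    have hs : |s| ≤ 1 := by
      rw [abs_mul] at h
      nlinarith
    have hs' := (abs_le.1 hs).1
    have hb := one_add_mul_le_pow (a := ((p : ℝ) + 1) * (1 + s) - 1) (by
      have : 0 ≤ ((p : ℝ) + 1) * (1 + s) := mul_nonneg (by positivity) (by linarith)
      linarith) (2 * p + 2)
    rw [show (1 : ℝ) + (((p : ℝ) + 1) * (1 + s) - 1) = ((p : ℝ) + 1) * (1 + s) by ring,
      mul_pow] at hb
    push_cast at hb
    have hU : burkholder p z (z * s) = z ^ (2 * p + 2) * (1 - ((p : ℝ) + 1) * (1 + s)) := by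
      rw [burkholder, if_pos h]; ring
    rw [hU, show z + z * s = z * (1 + s) by ring, mul_pow]
    have hz2 : (0 : ℝ) ≤ z ^ (2 * p + 2) := Even.pow_nonneg ⟨p + 1, by ring⟩ z
    nlinarith [mul_le_mul_of_nonneg_left hb hz2]
  rcases le_total |w| |z| with h | h
  · exact key z w h
  · rw [burkholder_comm, add_comm z w]
    refine le_trans (sub_le_sub_right ?_ _) (key w z h)
    rw [← Even.pow_abs ⟨p + 1, by ring⟩ z, ← Even.pow_abs ⟨p + 1, by ring⟩ w]
    gcongr

/-! ### Walsh functions, coefficients and partial sums on the dyadic grid -/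

theorem rademacher_eq_or (n : ℕ) (x : ℝ) : rademacher n x = 1 ∨ rademacher n x = -1 := by
  unfold rademacher; split_ifs <;> simp

theorem walsh_eq_digitProd (n : ℕ) (x : ℝ) : walsh n x = digitProd (fun j => rademacher j x) n :=
  rfl

theorem walsh_eq_or (n : ℕ) (x : ℝ) : walsh n x = 1 ∨ walsh n x = -1 :=
  digitProd_eq_or _ (fun i => rademacher_eq_or i x) n

theorem walsh_mul_self (n : ℕ) (x : ℝ) : walsh n x * walsh n x = 1 := by
  rcases walsh_eq_or n x with h | h <;> simp [h]

theorem rademacher_succ (n : ℕ) (x : ℝ) : rademacher (n + 1) x = rademacher n (2 * x) := by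
  unfold rademacher
  rw [pow_succ, mul_assoc]

theorem rademacher_add_nat (n m : ℕ) (x : ℝ) : rademacher n (x + m) = rademacher n x := by
  unfold rademacher
  rw [mul_add, show (2 : ℝ) ^ n * (m : ℝ) = ((2 ^ n * m : ℕ) : ℝ) by push_cast; ring,
    Int.fract_add_natCast]

theorem walsh_add_nat (n m : ℕ) (x : ℝ) : walsh n (x + m) = walsh n x := by
  simp only [walsh_eq_digitProd, rademacher_add_nat]

theorem walsh_two_mul (n : ℕ) (x : ℝ) : walsh (2 * n) x = walsh n (2 * x) := by
  simp only [walsh_eq_digitProd, digitProd_two_mul, rademacher_succ]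

theorem walsh_two_mul_add_one (n : ℕ) (x : ℝ) :
    walsh (2 * n + 1) x = rademacher 0 x * walsh n (2 * x) := by
  simp only [walsh_eq_digitProd, digitProd_two_mul_add_one, rademacher_succ]

/-- The value of the Walsh function `w_j` at the left end point of the `k`-th dyadic interval of
length `2⁻ᴺ`. -/
noncomputable def gridWalsh (N j k : ℕ) : ℝ := walsh j (k / 2 ^ N)

theorem gridWalsh_mul_self (N j k : ℕ) : gridWalsh N j k * gridWalsh N j k = 1 :=
  walsh_mul_self _ _

theorem gridWalsh_zero (N k : ℕ) : gridWalsh N 0 k = 1 := by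
  simp [gridWalsh, walsh]

theorem two_mul_grid_left (N k : ℕ) : 2 * ((k : ℝ) / 2 ^ (N + 1)) = k / 2 ^ N := by
  rw [pow_succ]; field_simp

theorem two_mul_grid_right (N k : ℕ) :
    2 * (((2 ^ N + k : ℕ) : ℝ) / 2 ^ (N + 1)) = k / 2 ^ N + (1 : ℕ) := by
  rw [pow_succ]; push_cast; field_simp; ring

theorem rademacher_zero_grid_left {N k : ℕ} (hk : k < 2 ^ N) :
    rademacher 0 ((k : ℝ) / 2 ^ (N + 1)) = 1 := by
  have hk' : (k : ℝ) < 2 ^ N := by exact_mod_cast hk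
  have h2 : (k : ℝ) / 2 ^ (N + 1) < 1 / 2 := by
    rw [div_lt_div_iff₀ (by positivity) (by norm_num), pow_succ]; linarith
  rw [rademacher, pow_zero, one_mul, Int.fract_eq_self.2 ⟨by positivity, by linarith⟩, if_pos h2]

theorem rademacher_zero_grid_right {N k : ℕ} (hk : k < 2 ^ N) :
    rademacher 0 (((2 ^ N + k : ℕ) : ℝ) / 2 ^ (N + 1)) = -1 := by
  have hk' : (k : ℝ) < 2 ^ N := by exact_mod_cast hk
  have h2 : 1 / 2 ≤ ((2 ^ N + k : ℕ) : ℝ) / 2 ^ (N + 1) := by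
    rw [div_le_div_iff₀ (by norm_num) (by positivity), pow_succ]; push_cast
    linarith [Nat.cast_nonneg (α := ℝ) k]
  have h3 : ((2 ^ N + k : ℕ) : ℝ) / 2 ^ (N + 1) < 1 := by
    rw [div_lt_one (by positivity), pow_succ]; push_cast
    linarith
  rw [rademacher, pow_zero, one_mul, Int.fract_eq_self.2 ⟨by positivity, h3⟩,
    if_neg (not_lt.2 h2)]

theorem gridWalsh_even_left (N n k : ℕ) : gridWalsh (N + 1) (2 * n) k = gridWalsh N n k := by
  rw [gridWalsh, walsh_two_mul, two_mul_grid_left, gridWalsh]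

theorem gridWalsh_even_right (N n k : ℕ) :
    gridWalsh (N + 1) (2 * n) (2 ^ N + k) = gridWalsh N n k := by
  rw [gridWalsh, walsh_two_mul, two_mul_grid_right, walsh_add_nat, gridWalsh]

theorem gridWalsh_odd_left {N k : ℕ} (n : ℕ) (hk : k < 2 ^ N) :
    gridWalsh (N + 1) (2 * n + 1) k = gridWalsh N n k := by
  rw [gridWalsh, walsh_two_mul_add_one, two_mul_grid_left, rademacher_zero_grid_left hk, one_mul,
    gridWalsh]

theorem gridWalsh_odd_right {N k : ℕ} (n : ℕ) (hk : k < 2 ^ N) :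
    gridWalsh (N + 1) (2 * n + 1) (2 ^ N + k) = -gridWalsh N n k := by
  rw [gridWalsh, walsh_two_mul_add_one, two_mul_grid_right, walsh_add_nat,
    rademacher_zero_grid_right hk, neg_one_mul, gridWalsh]

theorem sum_grid_succ (N : ℕ) (F : ℕ → ℝ) :
    ∑ k ∈ Finset.range (2 ^ (N + 1)), F k
      = ∑ k ∈ Finset.range (2 ^ N), F k + ∑ k ∈ Finset.range (2 ^ N), F (2 ^ N + k) := by
  rw [pow_succ, mul_two, Finset.sum_range_add]

/-- Walsh coefficients of a function on the dyadic grid of level `N`. -/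
noncomputable def gridCoeff (N : ℕ) (G : ℕ → ℝ) (j : ℕ) : ℝ :=
  (∑ k ∈ Finset.range (2 ^ N), gridWalsh N j k * G k) / 2 ^ N

/-- Walsh partial sums of a function on the dyadic grid of level `N`. -/
noncomputable def gridSum (N m : ℕ) (G : ℕ → ℝ) (k : ℕ) : ℝ :=
  ∑ j ∈ Finset.range m, gridCoeff N G j * gridWalsh N j k

theorem gridCoeff_neg (N : ℕ) (G : ℕ → ℝ) (j : ℕ) :
    gridCoeff N (fun k => -G k) j = -gridCoeff N G j := by
  simp [gridCoeff, Finset.sum_neg_distrib, neg_div]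

theorem gridSum_neg (N m : ℕ) (G : ℕ → ℝ) (k : ℕ) :
    gridSum N m (fun k => -G k) k = -gridSum N m G k := by
  simp [gridSum, gridCoeff_neg, Finset.sum_neg_distrib]

theorem gridCoeff_even (N : ℕ) (G : ℕ → ℝ) (n : ℕ) :
    gridCoeff (N + 1) G (2 * n)
      = (gridCoeff N G n + gridCoeff N (fun k => G (2 ^ N + k)) n) / 2 := by
  simp only [gridCoeff, sum_grid_succ, gridWalsh_even_right]
  simp only [gridWalsh_even_left]
  rw [pow_succ]; field_simp

theorem gridCoeff_odd (N : ℕ) (G : ℕ → ℝ) (n : ℕ) :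
    gridCoeff (N + 1) G (2 * n + 1)
      = (gridCoeff N G n - gridCoeff N (fun k => G (2 ^ N + k)) n) / 2 := by
  have h1 : ∑ k ∈ Finset.range (2 ^ N), gridWalsh (N + 1) (2 * n + 1) k * G k
      = ∑ k ∈ Finset.range (2 ^ N), gridWalsh N n k * G k :=
    Finset.sum_congr rfl fun k hk => by rw [gridWalsh_odd_left n (Finset.mem_range.1 hk)]
  have h2 : ∑ k ∈ Finset.range (2 ^ N), gridWalsh (N + 1) (2 * n + 1) (2 ^ N + k) * G (2 ^ N + k)
      = -∑ k ∈ Finset.range (2 ^ N), gridWalsh N n k * G (2 ^ N + k) := by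
    rw [← Finset.sum_neg_distrib]
    exact Finset.sum_congr rfl fun k hk => by
      rw [gridWalsh_odd_right n (Finset.mem_range.1 hk), neg_mul]
  simp only [gridCoeff, sum_grid_succ, h1, h2]
  rw [pow_succ]; field_simp; ring

/-- The coefficients at 2n and 2n+1 are half the sum and half the difference of those of the two
halves of G, and the two Walsh functions agree on the left half, so each pair recovers the left
coefficient. -/
theorem gridSum_even_left {N k : ℕ} (m : ℕ) (G : ℕ → ℝ) (hk : k < 2 ^ N) :
    gridSum (N + 1) (2 * m) G k = gridSum N m G k := by
  unfold gridSum
  rw [sum_range_mul]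
  refine Finset.sum_congr rfl fun n _ => ?_
  simp only [Finset.sum_range_succ, Finset.sum_range_zero, zero_add, add_zero, gridCoeff_even,
    gridCoeff_odd, gridWalsh_even_left, gridWalsh_odd_left n hk]
  ring

theorem gridSum_even_right {N k : ℕ} (m : ℕ) (G : ℕ → ℝ) (hk : k < 2 ^ N) :
    gridSum (N + 1) (2 * m) G (2 ^ N + k) = gridSum N m (fun k => G (2 ^ N + k)) k := by
  unfold gridSum
  rw [sum_range_mul]
  refine Finset.sum_congr rfl fun n _ => ?_
  simp only [Finset.sum_range_succ, Finset.sum_range_zero, zero_add, add_zero, gridCoeff_even,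
    gridCoeff_odd, gridWalsh_even_right, gridWalsh_odd_right n hk]
  ring

/-! ### The `L^(2p+2)` bound for Walsh partial sums -/

/-- Up to the starting values, the arguments are the parts of w_m G from j < m and from j > m. As j
< m exactly when the highest differing digit is 1 in m, these are the martingale differences of w_m
G at the levels where m has digit 1, respectively 0. Splitting the grid into halves reads the lowest
digit of m and shifts only one argument, by opposite amounts, so concavity in each variable closes
the induction. -/
theorem sum_burkholder_le (p N : ℕ) : ∀ m < 2 ^ N, ∀ (G : ℕ → ℝ) (z w : ℝ),
    ∑ k ∈ Finset.range (2 ^ N), burkholder p (z + gridWalsh N m k * gridSum N m G k)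
      (w + gridWalsh N m k * G k - gridCoeff N G m - gridWalsh N m k * gridSum N m G k)
      ≤ 2 ^ N * burkholder p z w := by
  induction N with
  | zero =>
    intro m hm G z w
    have : m = 0 := by simpa using hm
    subst this
    simp [gridSum, gridCoeff, gridWalsh_zero]
  | succ N ih =>
    intro m hm G z w
    set G' : ℕ → ℝ := fun k => G (2 ^ N + k) with hG'
    rw [sum_grid_succ]
    obtain ⟨n, rfl | rfl⟩ : ∃ n, m = 2 * n ∨ m = 2 * n + 1 := ⟨m / 2, by omega⟩
    · have hn : n < 2 ^ N := by rw [pow_succ] at hm; omega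
      set δ := (gridCoeff N G n - gridCoeff N G' n) / 2 with hδ
      have h1 := ih n hn G z (w + δ)
      have h2 := ih n hn G' z (w - δ)
      have h3 := burkholder_midpoint_right p z w δ
      refine le_trans (add_le_add (le_trans (le_of_eq ?_) h1) (le_trans (le_of_eq ?_) h2)) ?_
      · refine Finset.sum_congr rfl fun k hk => ?_
        rw [gridWalsh_even_left, gridSum_even_left n G (Finset.mem_range.1 hk), gridCoeff_even]
        congr 1
        rw [hδ]; ring
      · refine Finset.sum_congr rfl fun k hk => ?_
        rw [gridWalsh_even_right, gridSum_even_right n G (Finset.mem_range.1 hk), gridCoeff_even]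
        congr 1
        rw [hδ]; ring
      · rw [pow_succ, ← mul_add, mul_assoc]
        exact mul_le_mul_of_nonneg_left h3 (by positivity)
    · have hn : n < 2 ^ N := by rw [pow_succ] at hm; omega
      set c := (gridCoeff N G n + gridCoeff N G' n) / 2 with hc
      have h1 := ih n hn G (z + c) w
      -- For odd m the Walsh function changes sign on the right half; the sign is absorbed into G'.
      have h2 := ih n hn (fun k => -G' k) (z - c) w
      have h3 := burkholder_midpoint_left p z w c
      refine le_trans (add_le_add (le_trans (le_of_eq ?_) h1) (le_trans (le_of_eq ?_) h2)) ?_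
      · refine Finset.sum_congr rfl fun k hk => ?_
        have hs : gridSum (N + 1) (2 * n + 1) G k = gridSum N n G k + c * gridWalsh N n k := by
          rw [gridSum, Finset.sum_range_succ, ← gridSum,
            gridSum_even_left n G (Finset.mem_range.1 hk), gridCoeff_even, gridWalsh_even_left]
        have hw := gridWalsh_mul_self N n k
        rw [gridWalsh_odd_left n (Finset.mem_range.1 hk), hs, gridCoeff_odd]
        congr 1
        · linear_combination c * hw
        · rw [hc] at *
          linear_combination (-(gridCoeff N G n + gridCoeff N G' n) / 2) * hw
      · refine Finset.sum_congr rfl fun k hk => ?_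
        have hs : gridSum (N + 1) (2 * n + 1) G (2 ^ N + k)
            = gridSum N n G' k + c * gridWalsh N n k := by
          rw [gridSum, Finset.sum_range_succ, ← gridSum,
            gridSum_even_right n G (Finset.mem_range.1 hk), gridCoeff_even, gridWalsh_even_right]
        have hw := gridWalsh_mul_self N n k
        rw [gridWalsh_odd_right n (Finset.mem_range.1 hk), hs, gridCoeff_odd, gridSum_neg,
          gridCoeff_neg]
        congr 1
        · linear_combination (-c) * hw
        · rw [hc] at *
          simp only [hG']
          linear_combination ((gridCoeff N G n + gridCoeff N G' n) / 2) * hw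
      · rw [pow_succ, ← mul_add, mul_assoc]
        exact mul_le_mul_of_nonneg_left h3 (by positivity)

/-- The Walsh partial sums are bounded on `L^(2p+2)` with constant `p + 1`. -/
theorem sum_gridSum_pow_le (p N m : ℕ) (hm : m < 2 ^ N) (G : ℕ → ℝ) :
    ∑ k ∈ Finset.range (2 ^ N), gridSum N m G k ^ (2 * p + 2)
      ≤ (p + 1) ^ (2 * p + 2) * ∑ k ∈ Finset.range (2 ^ N), G k ^ (2 * p + 2) := by
  -- With this start the two arguments add up to w_m G, and Burkholder's function is nonpositive at
  -- the starting point.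
  have h := sum_burkholder_le p N m hm G 0 (gridCoeff N G m)
  have h0 : burkholder p 0 (gridCoeff N G m) ≤ 0 := by
    rw [burkholder_comm]; exact burkholder_zero_right_nonpos _ _
  have hpow : ∀ k (y : ℝ), (gridWalsh N m k * y) ^ (2 * p + 2) = y ^ (2 * p + 2) := fun k y => by
    rw [mul_pow, show 2 * p + 2 = 2 * (p + 1) by ring, pow_mul (gridWalsh N m k), sq,
      gridWalsh_mul_self, one_pow, one_mul]
  have h1 := Finset.sum_le_sum fun k (_ : k ∈ Finset.range (2 ^ N)) =>
    pow_sub_le_burkholder p (0 + gridWalsh N m k * gridSum N m G k)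
      (gridCoeff N G m + gridWalsh N m k * G k - gridCoeff N G m
        - gridWalsh N m k * gridSum N m G k)
  rw [← Finset.mul_sum, Finset.sum_sub_distrib, ← Finset.mul_sum] at h1
  have e : ∀ k, gridWalsh N m k * gridSum N m G k
      + (gridCoeff N G m + gridWalsh N m k * G k - gridCoeff N G m
        - gridWalsh N m k * gridSum N m G k) = gridWalsh N m k * G k := fun k => by ring
  simp only [zero_add, e, hpow] at h1
  simp only [zero_add] at h
  have h2 : (2 : ℝ) ^ N * burkholder p 0 (gridCoeff N G m) ≤ 0 :=
    mul_nonpos_of_nonneg_of_nonpos (by positivity) h0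
  have h3 := mul_le_mul_of_nonneg_left (h.trans h2) (show (0 : ℝ) ≤ 2 * p + 2 by positivity)
  linarith

/-! ### Tensor products and the one-variable logarithmic kernels -/

/-- The operators act one coordinate at a time: the bound for one coordinate is applied with the
others frozen, and the sums are interchanged. -/
theorem sum_tensor_pow_le {X : Type*} [Fintype X] (q : ℕ) : ∀ (d : ℕ) (K : Fin d → X → X → ℝ)
    (c : Fin d → ℝ), (∀ i, 0 ≤ c i) →
    (∀ i (g : X → ℝ), ∑ x, (∑ y, K i x y * g y) ^ q ≤ c i * ∑ y, g y ^ q) →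
    ∀ G : (Fin d → X) → ℝ,
      ∑ x : Fin d → X, (∑ y : Fin d → X, (∏ i, K i (x i) (y i)) * G y) ^ q ≤ (∏ i, c i) * ∑ y, G y ^ q := by
  have split : ∀ (d : ℕ) (F : (Fin (d + 1) → X) → ℝ),
      ∑ x, F x = ∑ a, ∑ x, F (Fin.cons a x) := fun d F => by
    rw [← Fintype.sum_prod_type']
    exact (Fintype.sum_equiv (Fin.consEquiv fun _ => X) _ _ fun _ => rfl).symm
  intro d
  induction d with
  | zero => intro K c _ _ G; simp
  | succ d ih =>
    intro K c hc hK G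
    have ih' := fun b => ih (fun i => K i.succ) (fun i => c i.succ) (fun i => hc _)
      (fun i => hK _) (fun y => G (Fin.cons b y))
    simp only [split, Fin.prod_univ_succ, Fin.cons_zero, Fin.cons_succ]
    set H : X → (Fin d → X) → ℝ := fun b x =>
      ∑ y, (∏ i, K (Fin.succ i) (x i) (y i)) * G (Fin.cons b y) with hH
    calc ∑ a, ∑ x : Fin d → X, (∑ b, ∑ y : Fin d → X,
          (K 0 a b * ∏ i, K (Fin.succ i) (x i) (y i)) * G (Fin.cons b y)) ^ q
        = ∑ x, ∑ a, (∑ b, K 0 a b * H b x) ^ q := by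
          rw [Finset.sum_comm]
          simp only [hH, Finset.mul_sum, mul_assoc]
      _ ≤ ∑ x, c 0 * ∑ b, H b x ^ q := Finset.sum_le_sum fun x _ => hK 0 _
      _ = c 0 * ∑ b, ∑ x, H b x ^ q := by rw [← Finset.mul_sum, Finset.sum_comm]
      _ ≤ c 0 * ∑ b, (∏ i, c (Fin.succ i)) * ∑ y, G (Fin.cons b y) ^ q :=
          mul_le_mul_of_nonneg_left (Finset.sum_le_sum fun b _ => ih' b) (hc 0)
      _ = (c 0 * ∏ i, c (Fin.succ i)) * ∑ b, ∑ y, G (Fin.cons b y) ^ q := by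
          rw [← Finset.mul_sum, mul_assoc]

/-- The kernel of the logarithmic mean `l_n⁻¹ ∑ₖ S_{m(k)} / k` in one variable. -/
noncomputable def logKernel (n : ℕ) (m : ℕ → ℕ) (x y : ℝ) : ℝ :=
  1 / logWeight n * ∑ k ∈ Finset.Ico 1 n, (∑ j ∈ Finset.range (m k), walsh j x * walsh j y) / k

theorem logKernel_comm (n : ℕ) (m : ℕ → ℕ) (x y : ℝ) : logKernel n m x y = logKernel n m y x := by
  simp only [logKernel, mul_comm (walsh _ x)]

theorem logWeight_pos {n : ℕ} (hn : 2 ≤ n) : 0 < logWeight n := by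
  refine Finset.sum_pos (fun k hk => ?_) ⟨1, Finset.mem_Ico.2 ⟨le_rfl, by omega⟩⟩
  have : (0 : ℝ) < k := by exact_mod_cast (Finset.mem_Ico.1 hk).1
  positivity

theorem sum_logWeights {n : ℕ} (hn : 2 ≤ n) :
    ∑ k ∈ Finset.Ico 1 n, 1 / logWeight n * (1 / (k : ℝ)) = 1 := by
  rw [← Finset.mul_sum, ← logWeight, one_div_mul_cancel (logWeight_pos hn).ne']

theorem logWeights_nonneg (n k : ℕ) : 0 ≤ 1 / logWeight n * (1 / (k : ℝ)) :=
  mul_nonneg (one_div_nonneg.2 (Finset.sum_nonneg fun _ _ => by positivity)) (by positivity)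

theorem sum_logKernel_mul (N n : ℕ) (m : ℕ → ℕ) (G : ℕ → ℝ) (a : ℕ) :
    ∑ b ∈ Finset.range (2 ^ N), logKernel n m (a / 2 ^ N) (b / 2 ^ N) / 2 ^ N * G b
      = ∑ k ∈ Finset.Ico 1 n, 1 / logWeight n * (1 / (k : ℝ)) * gridSum N (m k) G a := by
  simp only [gridSum, gridCoeff, logKernel, gridWalsh, Finset.mul_sum, Finset.sum_mul,
    Finset.sum_div]
  rw [Finset.sum_comm]
  refine Finset.sum_congr rfl fun k _ => ?_
  rw [Finset.sum_comm]
  refine Finset.sum_congr rfl fun j _ => Finset.sum_congr rfl fun b _ => ?_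
  ring

theorem gridCoeff_one (N : ℕ) : ∀ j < 2 ^ N, gridCoeff N (fun _ => 1) j = if j = 0 then 1 else 0 := by
  induction N with
  | zero =>
    intro j hj
    have : j = 0 := by simpa using hj
    simp [this, gridCoeff, gridWalsh_zero]
  | succ N ih =>
    intro j hj
    rw [pow_succ] at hj
    obtain ⟨n, rfl | rfl⟩ : ∃ n, j = 2 * n ∨ j = 2 * n + 1 := ⟨j / 2, by omega⟩
    · rw [gridCoeff_even, ih n (by omega)]
      by_cases h : n = 0 <;> simp [h]
    · rw [gridCoeff_odd]; simp

theorem gridSum_one {N m : ℕ} (h1 : 1 ≤ m) (h2 : m ≤ 2 ^ N) (k : ℕ) :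
    gridSum N m (fun _ => 1) k = 1 := by
  unfold gridSum
  rw [Finset.sum_eq_single 0]
  · rw [gridCoeff_one N 0 (by positivity), gridWalsh_zero]; simp
  · intro j hj hj0
    rw [gridCoeff_one N j ((Finset.mem_range.1 hj).trans_le h2), if_neg hj0, zero_mul]
  · intro h; exact absurd (Finset.mem_range.2 (by omega)) h

/-- The weights 1/(k l_n) sum to 1, so Jensen's inequality passes the bound for partial sums to
their average. -/
theorem sum_logKernel_pow_le (p N n : ℕ) (hn : 2 ≤ n) (m : ℕ → ℕ)
    (hm : ∀ k ∈ Finset.Ico 1 n, m k < 2 ^ N) (G : ℕ → ℝ) :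
    ∑ a ∈ Finset.range (2 ^ N), (∑ b ∈ Finset.range (2 ^ N),
        logKernel n m (a / 2 ^ N) (b / 2 ^ N) / 2 ^ N * G b) ^ (2 * p + 2)
      ≤ (p + 1) ^ (2 * p + 2) * ∑ b ∈ Finset.range (2 ^ N), G b ^ (2 * p + 2) := by
  simp only [sum_logKernel_mul]
  refine (Finset.sum_le_sum fun a _ => Real.pow_arith_mean_le_arith_mean_pow_of_even _ _ _
    (fun k _ => logWeights_nonneg n k) (sum_logWeights hn) ⟨p + 1, by ring⟩).trans ?_
  rw [Finset.sum_comm]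
  simp only [← Finset.mul_sum]
  refine (Finset.sum_le_sum fun k hk => mul_le_mul_of_nonneg_left
    (sum_gridSum_pow_le p N (m k) (hm k hk) G) (logWeights_nonneg n k)).trans ?_
  rw [← Finset.sum_mul, sum_logWeights hn, one_mul]

theorem rieszKernel_nonneg (n : ℕ) (x y : ℝ) : 0 ≤ logKernel n id x y := by
  refine mul_nonneg (one_div_nonneg.2 (Finset.sum_nonneg fun _ _ => by positivity)) ?_
  have h := riesz_kernel_nonneg (fun i => rademacher i x * rademacher i y) (fun i => by
    rcases rademacher_eq_or i x with h | h <;> rcases rademacher_eq_or i y with h' | h' <;>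
      simp [h, h']) n
  simp only [digitProd_mul] at h
  exact h

/-- The kernel matrix is nonnegative, symmetric and has row sums 1, hence is doubly stochastic:
Jensen along rows, then summation along columns. -/
theorem sum_rieszKernel_pow_le (p N n : ℕ) (hn : 2 ≤ n) (hN : n ≤ 2 ^ N) (G : ℕ → ℝ) :
    ∑ a ∈ Finset.range (2 ^ N), (∑ b ∈ Finset.range (2 ^ N),
        logKernel n id (a / 2 ^ N) (b / 2 ^ N) / 2 ^ N * G b) ^ (2 * p + 2)
      ≤ ∑ b ∈ Finset.range (2 ^ N), G b ^ (2 * p + 2) := by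
  have h0 : ∀ a b : ℕ, 0 ≤ logKernel n id (a / 2 ^ N) (b / 2 ^ N) / 2 ^ N := fun a b =>
    div_nonneg (rieszKernel_nonneg _ _ _) (by positivity)
  have h1 : ∀ a : ℕ, ∑ b ∈ Finset.range (2 ^ N),
      logKernel n id (a / 2 ^ N) (b / 2 ^ N) / 2 ^ N = 1 := fun a => by
    have h := sum_logKernel_mul N n id (fun _ => 1) a
    simp only [mul_one] at h
    rw [h]
    refine Eq.trans ?_ (sum_logWeights hn)
    refine Finset.sum_congr rfl fun k hk => ?_
    rw [Finset.mem_Ico] at hk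
    rw [id, gridSum_one hk.1 (hk.2.le.trans hN), mul_one]
  refine (Finset.sum_le_sum fun a _ => Real.pow_arith_mean_le_arith_mean_pow_of_even _ _ _
    (fun b _ => h0 a b) (h1 a) ⟨p + 1, by ring⟩).trans ?_
  rw [Finset.sum_comm]
  simp only [← Finset.sum_mul]
  refine le_of_eq (Finset.sum_congr rfl fun b _ => ?_)
  simp only [logKernel_comm n id _ ((b : ℝ) / 2 ^ N), h1, one_mul]

/-! ### Duality with L log^b L, uniformly in b -/

/-- The coefficients of the Young-type inequality dual to `u log^b u`. -/
noncomputable def youngCoeff (b p : ℕ) : ℝ :=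
  Real.exp (6 * p + 12) / (Real.exp 4 * (6 * (p + 1)) ^ b) ^ (2 * p + 1)

theorem youngCoeff_nonneg (b p : ℕ) : 0 ≤ youngCoeff b p := by
  unfold youngCoeff; positivity

/-- The factor 6^(2p+1) absorbs the one surplus p + 1, so the b-th powers cancel; what remains is
e^(6p+12) / e^(4(2p+1)). -/
theorem youngCoeff_mul_le (b p : ℕ) :
    youngCoeff b p * (((p : ℝ) + 1) ^ (2 * p + 2)) ^ b ≤ Real.exp (8 - 2 * p) := by
  have h1 : ((p : ℝ) + 1) ^ (2 * p + 2) ≤ (6 * ((p : ℝ) + 1)) ^ (2 * p + 1) := by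
    rw [mul_pow, pow_succ _ (2 * p + 1), mul_comm]
    refine mul_le_mul_of_nonneg_right ?_ (by positivity)
    have : p + 1 ≤ 6 ^ (2 * p + 1) :=
      ((by omega : p + 1 ≤ 2 * p + 1).trans (Nat.lt_pow_self (by norm_num)).le)
    exact_mod_cast this
  have h2 : Real.exp (6 * p + 12) = Real.exp (8 - 2 * p) * Real.exp 4 ^ (2 * p + 1) := by
    rw [← Real.exp_nat_mul, ← Real.exp_add]
    congr 1
    push_cast; ring
  have h3 : (((p : ℝ) + 1) ^ (2 * p + 2)) ^ b ≤ ((6 * ((p : ℝ) + 1)) ^ b) ^ (2 * p + 1) := by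
    rw [← pow_mul _ b, mul_comm b, pow_mul _ (2 * p + 1)]
    gcongr
  unfold youngCoeff
  rw [div_mul_eq_mul_div, div_le_iff₀ (by positivity), h2, mul_assoc]
  refine mul_le_mul_of_nonneg_left ?_ (Real.exp_pos _).le
  rw [mul_pow]
  exact mul_le_mul_of_nonneg_left h3 (by positivity)

/-- For u > e⁶ take p + 1 = ⌊log u / 6⌋ and M = e⁴(6(p+1))^b. If v ≤ M, then v ≤ e⁴ log^b u. If v >
M, then u ≤ e^(6p+12) and the factor (v/M)^(2p+1) > 1 can be inserted. -/
theorem mul_le_young (b : ℕ) {u v : ℝ} (hv : 0 ≤ v) :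
    u * v ≤ Real.exp 6 * (1 + v ^ 2) ∨ ∃ p : ℕ,
      u * v ≤ Real.exp 4 * (u * |Real.log u| ^ b) + youngCoeff b p * v ^ (2 * p + 2) := by
  by_cases h : u ≤ Real.exp 6
  · left
    exact mul_le_mul h (by nlinarith [sq_nonneg (v - 1)]) hv (Real.exp_pos _).le
  · right
    have hu0 : 0 < u := (Real.exp_pos 6).trans (not_le.1 h)
    have hL : 6 < Real.log u := (Real.lt_log_iff_exp_lt hu0).2 (not_le.1 h)
    have hm1 : 1 ≤ ⌊Real.log u / 6⌋₊ := Nat.le_floor (by push_cast; linarith)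
    have hm2 := Nat.floor_le (show 0 ≤ Real.log u / 6 by linarith)
    have hm3 := Nat.lt_floor_add_one (Real.log u / 6)
    obtain ⟨p, hp⟩ : ∃ p, ⌊Real.log u / 6⌋₊ = p + 1 := ⟨_, (Nat.sub_add_cancel hm1).symm⟩
    rw [hp] at hm2 hm3
    push_cast at hm2 hm3
    refine ⟨p, ?_⟩
    have hr : 0 ≤ youngCoeff b p * v ^ (2 * p + 2) :=
      mul_nonneg (youngCoeff_nonneg b p) (by positivity)
    have hl : 0 ≤ Real.exp 4 * (u * |Real.log u| ^ b) := by positivity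
    rw [abs_of_pos (by linarith)] at hl ⊢
    set M : ℝ := Real.exp 4 * (6 * (p + 1)) ^ b with hM
    have hM0 : 0 < M := by positivity
    by_cases hvM : v ≤ M
    · have : M ≤ Real.exp 4 * Real.log u ^ b := by
        rw [hM]
        have : 6 * ((p : ℝ) + 1) ≤ Real.log u := by linarith
        gcongr
      calc u * v ≤ u * (Real.exp 4 * Real.log u ^ b) := by gcongr; exact hvM.trans this
        _ = Real.exp 4 * (u * Real.log u ^ b) := by ring
        _ ≤ _ := by linarith
    · have h1 : M ^ (2 * p + 1) ≤ v ^ (2 * p + 1) := by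
        gcongr; exact (not_le.1 hvM).le
      have h2 : u ≤ Real.exp (6 * p + 12) := by
        rw [← Real.exp_log hu0]
        exact Real.exp_le_exp.2 (by linarith)
      have h3 : u * v ≤ youngCoeff b p * v ^ (2 * p + 2) := by
        unfold youngCoeff
        rw [← hM, div_mul_eq_mul_div, le_div_iff₀ (by positivity), pow_succ v (2 * p + 1)]
        calc u * v * M ^ (2 * p + 1) ≤ Real.exp (6 * p + 12) * v * v ^ (2 * p + 1) := by gcongr
          _ = _ := by ring
      linarith

/-- Duality between `L log^b L` and functions whose `L^(2p+2)` norms grow at most like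
`(p + 1)^b`, with a constant independent of `b`. -/
theorem exists_lintegral_mul_le : ∃ C : ℝ≥0, 0 < C ∧ ∀ (d b : ℕ) (μ : Measure (Fin d → ℝ))
    [IsProbabilityMeasure μ] (f h : (Fin d → ℝ) → ℝ), AEStronglyMeasurable f μ → Measurable h →
    (∀ p : ℕ, ∫⁻ x, ENNReal.ofReal (h x ^ (2 * p + 2)) ∂μ
      ≤ ENNReal.ofReal ((((p : ℝ) + 1) ^ (2 * p + 2)) ^ b)) →
    ∫⁻ x, ENNReal.ofReal (|f x| * |h x|) ∂μ
      ≤ C * (1 + eLpNorm (fun x => |f x| * Real.log |f x| ^ b) 1 μ) := by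
  have hsum : Summable fun p : ℕ => Real.exp (8 - 2 * p) := by
    have h1 : ∀ p : ℕ, Real.exp (8 - 2 * p) = Real.exp 8 * Real.exp (-2) ^ p := fun p => by
      rw [← Real.exp_nat_mul, ← Real.exp_add]; congr 1; ring
    simp only [h1]
    exact (summable_geometric_of_lt_one (Real.exp_pos _).le (by simp)).mul_left _
  set S : ℝ := ∑' p : ℕ, Real.exp (8 - 2 * p) with hS
  have hS0 : 0 ≤ S := tsum_nonneg fun p => (Real.exp_pos _).le
  set C : ℝ := Real.exp 6 * 2 + Real.exp 4 + S with hC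
  have hCpos : 0 < C := by positivity
  refine ⟨C.toNNReal, by simpa using hCpos, fun d b μ _ f h hf hh hp => ?_⟩
  rw [show ((C.toNNReal : ℝ≥0) : ℝ≥0∞) = ENNReal.ofReal C from rfl]
  set X := eLpNorm (fun x => |f x| * Real.log |f x| ^ b) 1 μ with hX
  have habs : ∀ (p : ℕ) x, |h x| ^ (2 * p + 2) = h x ^ (2 * p + 2) := fun p x =>
    Even.pow_abs ⟨p + 1, by ring⟩ _
  -- The exponent p depends on x; summing over all p removes this dependence.
  have hpt : ∀ x, ENNReal.ofReal (|f x| * |h x|)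
      ≤ (ENNReal.ofReal (Real.exp 6) * (1 + ENNReal.ofReal (h x ^ 2))
        + ENNReal.ofReal (Real.exp 4) * ‖|f x| * Real.log |f x| ^ b‖ₑ)
        + ∑' p : ℕ, ENNReal.ofReal (youngCoeff b p) * ENNReal.ofReal (h x ^ (2 * p + 2)) := by
    intro x
    rcases mul_le_young b (u := |f x|) (abs_nonneg (h x)) with h1 | ⟨p, h1⟩
    · refine le_trans ?_ (le_trans le_self_add le_self_add)
      rw [← ENNReal.ofReal_one, ← ENNReal.ofReal_add zero_le_one (sq_nonneg _),
        ← ENNReal.ofReal_mul (Real.exp_pos _).le]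
      rw [sq_abs] at h1
      exact ENNReal.ofReal_le_ofReal h1
    · refine le_trans ?_ (add_le_add le_add_self (ENNReal.le_tsum p))
      have e : ‖|f x| * Real.log |f x| ^ b‖ₑ
          = ENNReal.ofReal (|f x| * |Real.log (|f x|)| ^ b) := by
        rw [← ofReal_norm, norm_mul, norm_pow, Real.norm_eq_abs, abs_abs,
          Real.norm_eq_abs]
      rw [e, ← ENNReal.ofReal_mul (Real.exp_pos _).le,
        ← ENNReal.ofReal_mul (youngCoeff_nonneg b p), ← ENNReal.ofReal_add (by positivity)
          (mul_nonneg (youngCoeff_nonneg b p) (by rw [← habs]; positivity))]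
      rw [habs] at h1
      exact ENNReal.ofReal_le_ofReal h1
  have hm2 : ∀ p : ℕ, Measurable fun x => ENNReal.ofReal (h x ^ p) := fun p =>
    (hh.pow_const p).ennreal_ofReal
  have hlog : AEMeasurable (fun x => ‖|f x| * Real.log |f x| ^ b‖ₑ) μ := by
    have h1 : AEMeasurable (fun x => |f x|) μ := hf.aemeasurable.abs
    exact (h1.mul ((Real.measurable_log.comp_aemeasurable h1).pow_const b)).enorm
  have hint2 : ∫⁻ x, ENNReal.ofReal (h x ^ 2) ∂μ ≤ 1 := by
    simpa using hp 0
  calc ∫⁻ x, ENNReal.ofReal (|f x| * |h x|) ∂μ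
      ≤ ∫⁻ x, ((ENNReal.ofReal (Real.exp 6) * (1 + ENNReal.ofReal (h x ^ 2))
        + ENNReal.ofReal (Real.exp 4) * ‖|f x| * Real.log |f x| ^ b‖ₑ)
        + ∑' p : ℕ, ENNReal.ofReal (youngCoeff b p) * ENNReal.ofReal (h x ^ (2 * p + 2))) ∂μ :=
        lintegral_mono hpt
    _ = (ENNReal.ofReal (Real.exp 6) * (1 + ∫⁻ x, ENNReal.ofReal (h x ^ 2) ∂μ)
        + ENNReal.ofReal (Real.exp 4) * X)
        + ∑' p : ℕ, ENNReal.ofReal (youngCoeff b p)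
          * ∫⁻ x, ENNReal.ofReal (h x ^ (2 * p + 2)) ∂μ := by
        rw [lintegral_add_right _ (Measurable.tsum fun p => (hm2 _).const_mul _),
          lintegral_add_left (((hm2 2).const_add 1).const_mul _),
          lintegral_const_mul _ ((hm2 2).const_add 1), lintegral_add_left measurable_const,
          lintegral_const_mul'' _ hlog, lintegral_tsum fun p => ((hm2 _).const_mul _).aemeasurable,
          hX, eLpNorm_one_eq_lintegral_enorm]
        simp only [lintegral_const_mul _ (hm2 _), lintegral_const, measure_univ, mul_one]
    _ ≤ (ENNReal.ofReal (Real.exp 6) * (1 + 1) + ENNReal.ofReal (Real.exp 4) * X)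
        + ∑' p : ℕ, ENNReal.ofReal (Real.exp (8 - 2 * p)) := by
        gcongr with p
        refine (mul_le_mul_right (hp p) _).trans ?_
        rw [← ENNReal.ofReal_mul (youngCoeff_nonneg b p)]
        exact ENNReal.ofReal_le_ofReal (youngCoeff_mul_le b p)
    _ = (ENNReal.ofReal (Real.exp 6 * 2) + ENNReal.ofReal (Real.exp 4) * X)
        + ENNReal.ofReal S := by
        rw [hS, ENNReal.ofReal_tsum_of_nonneg (fun p => (Real.exp_pos _).le) hsum,
          ENNReal.ofReal_mul (Real.exp_pos _).le, one_add_one_eq_two]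
        simp
    _ ≤ ENNReal.ofReal C * (1 + X) := by
        rw [hC, ENNReal.ofReal_add (by positivity) hS0, ENNReal.ofReal_add (by positivity)
          (by positivity)]
        set α := ENNReal.ofReal (Real.exp 6 * 2)
        set β := ENNReal.ofReal (Real.exp 4)
        set γ := ENNReal.ofReal S
        calc α + β * X + γ ≤ α + β * X + γ + (β + α * X + γ * X) := le_self_add
          _ = (α + β + γ) * (1 + X) := by ring

/-! ### From the cube to the dyadic grid -/

theorem measurable_rademacher (n : ℕ) : Measurable (rademacher n) := by
  unfold rademacher
  exact Measurable.ite (measurableSet_lt (measurable_fract.comp (measurable_const_mul _))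
    measurable_const) measurable_const measurable_const

theorem measurable_walsh (n : ℕ) : Measurable (walsh n) := by
  unfold walsh
  induction n.bitIndices with
  | nil => simp
  | cons a l ih =>
    simp only [List.map_cons, List.prod_cons]
    exact (measurable_rademacher a).mul ih

theorem measurable_walshProd {d : ℕ} (j : Fin d → ℕ) : Measurable (walshProd j) :=
  Finset.measurable_fun_prod _ fun i _ => (measurable_walsh (j i)).comp (measurable_pi_apply i)

theorem abs_walshProd {d : ℕ} (j : Fin d → ℕ) (x : Fin d → ℝ) : |walshProd j x| = 1 := by
  rw [walshProd, Finset.abs_prod]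
  refine Finset.prod_eq_one fun i _ => ?_
  rcases walsh_eq_or (j i) (x i) with h | h <;> simp [h]

theorem walsh_eq_gridWalsh (N : ℕ) : ∀ j < 2 ^ N, ∀ k : ℕ, k < 2 ^ N → ∀ x : ℝ,
    (k : ℝ) / 2 ^ N ≤ x → x < (k + 1) / 2 ^ N → walsh j x = gridWalsh N j k := by
  induction N with
  | zero =>
    intro j hj k _ x _ _
    have : j = 0 := by simpa using hj
    simp [this, gridWalsh, walsh]
  | succ N ih =>
    intro j hj k hk x h1 h2
    rw [pow_succ] at hj hk
    have hp : (0 : ℝ) < 2 ^ N := by positivity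
    rw [div_le_iff₀ (by positivity), pow_succ] at h1
    rw [lt_div_iff₀ (by positivity), pow_succ] at h2
    rcases lt_or_ge k (2 ^ N) with hkN | hkN
    · have hwx : ∀ n < 2 ^ N, walsh n (2 * x) = gridWalsh N n k := fun n hn =>
        ih n hn k hkN _ (by rw [div_le_iff₀ hp]; linarith) (by rw [lt_div_iff₀ hp]; linarith)
      have hr : rademacher 0 x = 1 := by
        have h3 : (k : ℝ) + 1 ≤ 2 ^ N := by exact_mod_cast hkN
        have hx0 : 0 ≤ x := by
          have := Nat.cast_nonneg (α := ℝ) k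
          by_contra hneg
          nlinarith
        have hx1 : x < 1 / 2 := by
          by_contra hge
          nlinarith
        rw [rademacher, pow_zero, one_mul, Int.fract_eq_self.2 ⟨hx0, by linarith⟩, if_pos hx1]
      obtain ⟨n, rfl | rfl⟩ : ∃ n, j = 2 * n ∨ j = 2 * n + 1 := ⟨j / 2, by omega⟩
      · rw [walsh_two_mul, gridWalsh_even_left, hwx n (by omega)]
      · rw [walsh_two_mul_add_one, gridWalsh_odd_left n hkN, hwx n (by omega), hr, one_mul]
    · obtain ⟨l, rfl⟩ := Nat.exists_eq_add_of_le hkN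
      have hl : l < 2 ^ N := by omega
      push_cast at h1 h2
      have hwx : ∀ n < 2 ^ N, walsh n (2 * x) = gridWalsh N n l := fun n hn => by
        rw [show 2 * x = (2 * x - 1) + (1 : ℕ) by push_cast; ring, walsh_add_nat]
        exact ih n hn l hl (2 * x - 1) (by rw [div_le_iff₀ hp]; linarith)
          (by rw [lt_div_iff₀ hp]; linarith)
      have hr : rademacher 0 x = -1 := by
        have h3 : (l : ℝ) + 1 ≤ 2 ^ N := by exact_mod_cast hl
        have := Nat.cast_nonneg (α := ℝ) l
        have hx0 : 1 / 2 ≤ x := by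
          by_contra hneg
          nlinarith
        have hx1 : x < 1 := by
          by_contra hge
          nlinarith
        rw [rademacher, pow_zero, one_mul, Int.fract_eq_self.2 ⟨by linarith, hx1⟩,
          if_neg (not_lt.2 hx0)]
      obtain ⟨n, rfl | rfl⟩ : ∃ n, j = 2 * n ∨ j = 2 * n + 1 := ⟨j / 2, by omega⟩
      · rw [walsh_two_mul, gridWalsh_even_right, hwx n (by omega)]
      · rw [walsh_two_mul_add_one, gridWalsh_odd_right n hl, hwx n (by omega), hr, neg_one_mul]

/-- The lower corners of the dyadic cubes of side `2⁻ᴺ`. -/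
noncomputable def gridPoint {d : ℕ} (N : ℕ) (κ : Fin d → Fin (2 ^ N)) (i : Fin d) : ℝ :=
  ((κ i : ℕ) : ℝ) / 2 ^ N

/-- The dyadic cubes of side `2⁻ᴺ`. -/
def gridCube {d : ℕ} (N : ℕ) (κ : Fin d → Fin (2 ^ N)) : Set (Fin d → ℝ) :=
  Set.univ.pi fun i => Set.Ico (((κ i : ℕ) : ℝ) / 2 ^ N) ((((κ i : ℕ) : ℝ) + 1) / 2 ^ N)

theorem iUnion_gridCube (d N : ℕ) : ⋃ κ, gridCube (d := d) N κ = unitCube d := by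
  have hp : (0 : ℝ) < 2 ^ N := by positivity
  ext x
  simp only [Set.mem_iUnion, gridCube, unitCube, Set.mem_univ_pi, Set.mem_Ico]
  constructor
  · rintro ⟨κ, h⟩ i
    have h3 : (((κ i : ℕ) : ℝ)) + 1 ≤ 2 ^ N := by exact_mod_cast (κ i).2
    refine ⟨le_trans (by positivity) (h i).1, (h i).2.trans_le ?_⟩
    rwa [div_le_one hp]
  · intro h
    have hlt : ∀ i, ⌊x i * 2 ^ N⌋₊ < 2 ^ N := fun i => by
      rw [Nat.floor_lt (mul_nonneg (h i).1 hp.le)]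
      push_cast
      nlinarith [(h i).2]
    refine ⟨fun i => ⟨⌊x i * 2 ^ N⌋₊, hlt i⟩, fun i => ⟨?_, ?_⟩⟩
    · rw [div_le_iff₀ hp]
      exact Nat.floor_le (mul_nonneg (h i).1 hp.le)
    · rw [lt_div_iff₀ hp]
      exact Nat.lt_floor_add_one _

theorem pairwise_disjoint_gridCube (d N : ℕ) :
    Pairwise (Function.onFun Disjoint (gridCube (d := d) N)) := by
  have hp : (0 : ℝ) < 2 ^ N := by positivity
  intro κ l hne
  refine Set.disjoint_left.2 fun x hx hy => hne ?_
  simp only [gridCube, Set.mem_univ_pi, Set.mem_Ico, div_le_iff₀ hp, lt_div_iff₀ hp] at hx hy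
  funext i
  have h1 : ((κ i : ℕ) : ℝ) < (l i : ℕ) + 1 := (hx i).1.trans_lt (hy i).2
  have h2 : ((l i : ℕ) : ℝ) < (κ i : ℕ) + 1 := (hy i).1.trans_lt (hx i).2
  have h1' : (κ i : ℕ) < (l i : ℕ) + 1 := by exact_mod_cast h1
  have h2' : (l i : ℕ) < (κ i : ℕ) + 1 := by exact_mod_cast h2
  exact Fin.ext (by omega)

theorem measurableSet_gridCube {d N : ℕ} (κ : Fin d → Fin (2 ^ N)) :
    MeasurableSet (gridCube N κ) :=
  MeasurableSet.univ_pi fun _ => measurableSet_Ico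

theorem volume_gridCube {d N : ℕ} (κ : Fin d → Fin (2 ^ N)) :
    volume (gridCube N κ) = ENNReal.ofReal (1 / (2 ^ N) ^ d) := by
  rw [gridCube, Real.volume_pi_Ico]
  simp only [← sub_div, add_sub_cancel_left]
  rw [Finset.prod_const, Finset.card_univ, Fintype.card_fin, ← ENNReal.ofReal_pow (by positivity),
    div_pow, one_pow]

theorem lintegral_cubeMeasure_eq_sum {d : ℕ} (N : ℕ) (F : (Fin d → ℝ) → ℝ≥0∞)
    (hF : ∀ κ, ∀ x ∈ gridCube N κ, F x = F (gridPoint N κ)) :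
    ∫⁻ x, F x ∂(cubeMeasure d) = ENNReal.ofReal (1 / (2 ^ N) ^ d) * ∑ κ, F (gridPoint N κ) := by
  rw [cubeMeasure, ← iUnion_gridCube d N,
    lintegral_iUnion (fun κ => measurableSet_gridCube κ) (pairwise_disjoint_gridCube d N),
    tsum_fintype, Finset.mul_sum]
  refine Finset.sum_congr rfl fun κ _ => ?_
  rw [setLIntegral_congr_fun (measurableSet_gridCube κ) (hF κ), setLIntegral_const,
    volume_gridCube, mul_comm]

instance isProbabilityMeasure_cubeMeasure (d : ℕ) : IsProbabilityMeasure (cubeMeasure d) := by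
  constructor
  rw [cubeMeasure, Measure.restrict_apply_univ, unitCube, Real.volume_pi_Ico]
  simp

/-! ### The kernel of the mixed logarithmic mean -/

/-- The index of the partial sum that the mixed logarithmic mean takes in a coordinate. -/
def mixedIndex {d : ℕ} (B : Finset (Fin d)) (n : Fin d → ℕ) (i : Fin d) (k : ℕ) : ℕ :=
  if i ∈ B then n i - k else k

/-- The kernel of the mixed logarithmic mean. -/
noncomputable def mixedKernel {d : ℕ} (B : Finset (Fin d)) (n : Fin d → ℕ)
    (x y : Fin d → ℝ) : ℝ :=
  ∏ i, logKernel (n i) (mixedIndex B n i) (x i) (y i)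

theorem mixedKernel_comm {d : ℕ} (B : Finset (Fin d)) (n : Fin d → ℕ) (x y : Fin d → ℝ) :
    mixedKernel B n x y = mixedKernel B n y x :=
  Finset.prod_congr rfl fun _ _ => logKernel_comm _ _ _ _

theorem mixedKernel_eq_sum {d : ℕ} (B : Finset (Fin d)) (n : Fin d → ℕ) (x y : Fin d → ℝ) :
    mixedKernel B n x y = (1 / ∏ i, logWeight (n i)) *
      ∑ k ∈ Fintype.piFinset (fun i => Finset.Ico 1 (n i)),
        (∑ j ∈ Fintype.piFinset (fun i => Finset.range (if i ∈ B then n i - k i else k i)),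
          walshProd j y * walshProd j x) / ∏ i, (k i : ℝ) := by
  unfold mixedKernel logKernel
  rw [Finset.prod_mul_distrib, Finset.prod_div_distrib, Finset.prod_const_one,
    Finset.prod_univ_sum]
  congr 1
  refine Finset.sum_congr rfl fun k _ => ?_
  rw [Finset.prod_div_distrib, Finset.prod_univ_sum]
  congr 1
  refine Finset.sum_congr rfl fun j _ => ?_
  rw [Finset.prod_mul_distrib, mul_comm]
  rfl

theorem integrable_mul_walshProd {d : ℕ} {f : (Fin d → ℝ) → ℝ}
    (hf : Integrable f (cubeMeasure d)) (j : Fin d → ℕ) :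
    Integrable (fun y => f y * walshProd j y) (cubeMeasure d) :=
  hf.mul_bdd (c := 1) (measurable_walshProd j).aestronglyMeasurable
    (ae_of_all _ fun y => by rw [Real.norm_eq_abs, abs_walshProd])

theorem mixedLogMean_eq_integral {d : ℕ} (B : Finset (Fin d)) (n : Fin d → ℕ)
    {f : (Fin d → ℝ) → ℝ} (hf : Integrable f (cubeMeasure d)) (x : Fin d → ℝ) :
    Integrable (fun y => f y * mixedKernel B n x y) (cubeMeasure d) ∧
    mixedLogMean B n f x = ∫ y, f y * mixedKernel B n x y ∂(cubeMeasure d) := by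
  have e : ∀ y, f y * mixedKernel B n x y = (1 / ∏ i, logWeight (n i)) *
      ∑ k ∈ Fintype.piFinset (fun i => Finset.Ico 1 (n i)),
        (∑ j ∈ Fintype.piFinset (fun i => Finset.range (if i ∈ B then n i - k i else k i)),
          (f y * walshProd j y) * walshProd j x) / ∏ i, (k i : ℝ) := fun y => by
    rw [mixedKernel_eq_sum, mul_left_comm, Finset.mul_sum]
    congr 1
    refine Finset.sum_congr rfl fun k _ => ?_
    rw [← mul_div_assoc, Finset.mul_sum]
    simp only [mul_assoc]
  have h1 : ∀ j, Integrable (fun y => (f y * walshProd j y) * walshProd j x) (cubeMeasure d) :=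
    fun j => (integrable_mul_walshProd hf j).mul_const _
  have h2 : ∀ s : Finset (Fin d → ℕ), Integrable (fun y => ∑ j ∈ s,
      (f y * walshProd j y) * walshProd j x) (cubeMeasure d) :=
    fun s => integrable_finsetSum _ fun j _ => h1 j
  simp only [e]
  refine ⟨(integrable_finsetSum _ fun k _ => (h2 _).div_const _).const_mul _, ?_⟩
  rw [integral_const_mul, integral_finsetSum _ fun k _ => (h2 _).div_const _]
  unfold mixedLogMean partialSum
  congr 1
  refine Finset.sum_congr rfl fun k _ => ?_
  rw [integral_div, integral_finsetSum _ fun j _ => h1 j]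
  simp only [integral_mul_const, walshCoeff]

theorem mixedIndex_lt {d : ℕ} (B : Finset (Fin d)) (n : Fin d → ℕ) (i : Fin d) {k : ℕ}
    (hk : k ∈ Finset.Ico 1 (n i)) : mixedIndex B n i k < n i := by
  rw [Finset.mem_Ico] at hk
  unfold mixedIndex
  split_ifs <;> omega

theorem mixedKernel_eq_gridPoint {d N : ℕ} (B : Finset (Fin d)) (n : Fin d → ℕ)
    (hN : ∀ i, n i ≤ 2 ^ N) (κ : Fin d → Fin (2 ^ N)) {x : Fin d → ℝ} (hx : x ∈ gridCube N κ)
    (y : Fin d → ℝ) : mixedKernel B n x y = mixedKernel B n (gridPoint N κ) y := by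
  unfold mixedKernel logKernel
  refine Finset.prod_congr rfl fun i _ => ?_
  congr 1
  refine Finset.sum_congr rfl fun k hk => ?_
  congr 1
  refine Finset.sum_congr rfl fun j hj => ?_
  have hj' : j < 2 ^ N := (Finset.mem_range.1 hj).trans ((mixedIndex_lt B n i hk).trans_le (hN i))
  have hxi := hx i (Set.mem_univ i)
  rw [walsh_eq_gridWalsh N j hj' _ (κ i).2 (x i) hxi.1 hxi.2]
  rfl

theorem measurable_mixedKernel {d : ℕ} (B : Finset (Fin d)) (n : Fin d → ℕ) (x : Fin d → ℝ) :
    Measurable (mixedKernel B n x) := by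
  have : mixedKernel B n x = fun y => _ := funext (mixedKernel_eq_sum B n x)
  rw [this]
  exact (Finset.measurable_fun_sum _ fun k _ => (Finset.measurable_fun_sum _ fun j _ =>
    (measurable_walshProd j).mul_const _).div_const _).const_mul _

/-- The mixed logarithmic mean is bounded on `L^(2p+2)` of the grid with constant
`(p + 1)^|B|`. -/
theorem sum_mixedKernel_pow_le {d N : ℕ} (B : Finset (Fin d)) (n : Fin d → ℕ)
    (hn : ∀ i, 2 ≤ n i) (hN : ∀ i, n i ≤ 2 ^ N) (p : ℕ) (G : (Fin d → Fin (2 ^ N)) → ℝ) :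
    ∑ κ, (1 / (2 ^ N) ^ d * ∑ l, mixedKernel B n (gridPoint N κ) (gridPoint N l) * G l)
        ^ (2 * p + 2)
      ≤ (((p : ℝ) + 1) ^ (2 * p + 2)) ^ B.card * ∑ l, G l ^ (2 * p + 2) := by
  have h := sum_tensor_pow_le (X := Fin (2 ^ N)) (2 * p + 2) d
    (fun i a b => logKernel (n i) (mixedIndex B n i) (((a : ℕ) : ℝ) / 2 ^ N)
      (((b : ℕ) : ℝ) / 2 ^ N) / 2 ^ N)
    (fun i => if i ∈ B then ((p : ℝ) + 1) ^ (2 * p + 2) else 1)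
    (fun i => by split_ifs <;> positivity) (fun i g => ?_) G
  · rw [Finset.prod_ite_mem, Finset.univ_inter, Finset.prod_const] at h
    refine le_trans (le_of_eq ?_) h
    refine Finset.sum_congr rfl fun κ _ => ?_
    congr 1
    rw [Finset.mul_sum]
    refine Finset.sum_congr rfl fun l _ => ?_
    rw [Finset.prod_div_distrib, Finset.prod_const, Finset.card_univ, Fintype.card_fin,
      ← mul_assoc, one_div_mul_eq_div]
    rfl
  -- Extension by zero to ℕ, where the one-variable bounds are stated.
  · obtain ⟨g', hg'⟩ : ∃ g' : ℕ → ℝ, ∀ a : Fin (2 ^ N), g' a = g a :=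
      ⟨fun k => if hk : k < 2 ^ N then g ⟨k, hk⟩ else 0, fun a => by simp⟩
    obtain rfl : (fun a : Fin (2 ^ N) => g' a) = g := funext hg'
    dsimp only
    rw [Fin.sum_univ_eq_sum_range (fun b => g' b ^ (2 * p + 2))]
    simp only [fun x : ℝ => Fin.sum_univ_eq_sum_range (fun b =>
      logKernel (n i) (mixedIndex B n i) x ((b : ℝ) / 2 ^ N) / 2 ^ N * g' b) (2 ^ N)]
    rw [Fin.sum_univ_eq_sum_range (fun a => (∑ b ∈ Finset.range (2 ^ N),
      logKernel (n i) (mixedIndex B n i) ((a : ℝ) / 2 ^ N) ((b : ℝ) / 2 ^ N) / 2 ^ N * g' b)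
        ^ (2 * p + 2))]
    by_cases hi : i ∈ B
    · rw [if_pos hi]
      exact sum_logKernel_pow_le p N (n i) (hn i) _
        (fun k hk => (mixedIndex_lt B n i hk).trans_le (hN i)) g'
    · rw [if_neg hi, one_mul, show mixedIndex B n i = id from funext fun k => if_neg hi]
      exact sum_rieszKernel_pow_le p N (n i) (hn i) (hN i) g'

end WalshLog

/-! ### Proof of the theorem by duality -/

theorem theorem1 :
    ∃ C : ℝ≥0, ∀ (d : ℕ) (B : Finset (Fin d)) (n : Fin d → ℕ), (∀ i, 2 ≤ n i) →
      ∀ f : (Fin d → ℝ) → ℝ, WalshLog.MemLLog B.card f →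
        eLpNorm (WalshLog.mixedLogMean B n f) 1 (WalshLog.cubeMeasure d) ≤
          (C : ℝ≥0∞) *
            (1 + eLpNorm (fun x => |f x| * Real.log |f x| ^ B.card) 1
              (WalshLog.cubeMeasure d)) := by
  open WalshLog in
  obtain ⟨C, hC, hdual⟩ := exists_lintegral_mul_le
  refine ⟨C, fun d B n hn f hf => ?_⟩
  have hfm : AEStronglyMeasurable f (cubeMeasure d) := hf.1
  set X := eLpNorm (fun x => |f x| * Real.log |f x| ^ B.card) 1 (cubeMeasure d) with hX
  by_cases hXtop : X = ∞
  · rw [hXtop, add_top, ENNReal.mul_top (by exact_mod_cast hC.ne')]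
    exact le_top
  -- Duality against h = 1 yields integrability from the finiteness of X.
  have hint : Integrable f (cubeMeasure d) := by
    refine ⟨hfm, ?_⟩
    have h := hdual d B.card (cubeMeasure d) f (fun _ => 1) hfm measurable_const (fun p => by
      simp only [one_pow, lintegral_const, measure_univ, mul_one]
      refine ENNReal.ofReal_le_ofReal (one_le_pow₀ (one_le_pow₀ ?_))
      linarith [Nat.cast_nonneg (α := ℝ) p])
    have e : ∀ x, ENNReal.ofReal (|f x| * |1|) = ‖f x‖ₑ := fun x => by
      rw [abs_one, mul_one, ← Real.norm_eq_abs, ofReal_norm]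
    simp only [e] at h
    exact h.trans_lt (ENNReal.mul_lt_top ENNReal.coe_lt_top
      (ENNReal.add_lt_top.2 ⟨ENNReal.one_lt_top, lt_top_iff_ne_top.2 hXtop⟩))
  obtain ⟨N, hN⟩ : ∃ N, ∀ i, n i ≤ 2 ^ N :=
    ⟨∑ i, n i, fun i => (Finset.single_le_sum (f := n) (fun _ _ => Nat.zero_le _)
      (Finset.mem_univ i)).trans (Nat.lt_pow_self (by norm_num)).le⟩
  set T := mixedLogMean B n f with hT
  have hTeq : ∀ x, T x = ∫ y, f y * mixedKernel B n x y ∂(cubeMeasure d) :=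
    fun x => (mixedLogMean_eq_integral B n hint x).2
  have hTstep : ∀ κ, ∀ x ∈ gridCube N κ, T x = T (gridPoint N κ) := fun κ x hx => by
    rw [hTeq, hTeq]
    simp only [mixedKernel_eq_gridPoint B n hN κ hx]
  have hvol : (0 : ℝ) ≤ 1 / (2 ^ N) ^ d := by positivity
  choose σ hσ hσT using fun κ : Fin d → Fin (2 ^ N) =>
    show ∃ s : ℝ, |s| = 1 ∧ s * T (gridPoint N κ) = |T (gridPoint N κ)| by
      rcases abs_choice (T (gridPoint N κ)) with h | h
      · exact ⟨1, by simp, by rw [one_mul, h]⟩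
      · exact ⟨-1, by simp, by rw [neg_one_mul, h]⟩
  -- The operator applied to the signs σ of Tf; symmetry of the kernel makes it its own adjoint.
  set h : (Fin d → ℝ) → ℝ := fun y =>
    1 / (2 ^ N) ^ d * ∑ κ, mixedKernel B n (gridPoint N κ) y * σ κ with hh
  have hhm : Measurable h := (Finset.measurable_fun_sum _ fun κ _ =>
    (measurable_mixedKernel B n _).mul_const _).const_mul _
  have hhstep : ∀ κ, ∀ x ∈ gridCube N κ, h x = h (gridPoint N κ) := fun κ x hx => by
    simp only [hh]
    congr 1
    refine Finset.sum_congr rfl fun l _ => ?_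
    rw [mixedKernel_comm, mixedKernel_eq_gridPoint B n hN κ hx, mixedKernel_comm]
  have hpow : ∀ p : ℕ, ∫⁻ x, ENNReal.ofReal (h x ^ (2 * p + 2)) ∂(cubeMeasure d)
      ≤ ENNReal.ofReal ((((p : ℝ) + 1) ^ (2 * p + 2)) ^ B.card) := fun p => by
    rw [lintegral_cubeMeasure_eq_sum N _ fun κ x hx => by rw [hhstep κ x hx],
      ← ENNReal.ofReal_sum_of_nonneg fun κ _ => Even.pow_nonneg ⟨p + 1, by ring⟩ _,
      ← ENNReal.ofReal_mul hvol]
    refine ENNReal.ofReal_le_ofReal ?_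
    have h1 := sum_mixedKernel_pow_le B n hn hN p σ
    have h2 : ∀ κ, σ κ ^ (2 * p + 2) = 1 := fun κ => by
      rw [← Even.pow_abs ⟨p + 1, by ring⟩, hσ, one_pow]
    simp only [h2, Finset.sum_const, Finset.card_univ, Fintype.card_fun, Fintype.card_fin,
      nsmul_eq_mul, mul_one] at h1
    have e : ∀ κ, 1 / (2 ^ N) ^ d * ∑ l, mixedKernel B n (gridPoint N κ) (gridPoint N l) * σ l
        = h (gridPoint N κ) := fun κ => by
      rw [hh]
      simp only
      congr 1
      exact Finset.sum_congr rfl fun l _ => by rw [mixedKernel_comm]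
    simp only [e] at h1
    refine (mul_le_mul_of_nonneg_left h1 hvol).trans (le_of_eq ?_)
    push_cast
    field_simp
  have hnorm : eLpNorm T 1 (cubeMeasure d)
      = ENNReal.ofReal (∫ y, f y * h y ∂(cubeMeasure d)) := by
    rw [eLpNorm_one_eq_lintegral_enorm,
      lintegral_cubeMeasure_eq_sum N _ fun κ x hx => by rw [hTstep κ x hx]]
    simp only [← ofReal_norm, Real.norm_eq_abs]
    rw [← ENNReal.ofReal_sum_of_nonneg fun κ _ => abs_nonneg _, ← ENNReal.ofReal_mul hvol]
    congr 1
    have e : ∀ y, f y * h y = 1 / (2 ^ N) ^ d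
        * ∑ κ, (f y * mixedKernel B n (gridPoint N κ) y) * σ κ := fun y => by
      simp only [hh]
      rw [mul_left_comm, Finset.mul_sum]
      simp only [mul_assoc]
    simp only [e]
    rw [integral_const_mul, integral_finsetSum _ fun κ _ =>
      (mixedLogMean_eq_integral B n hint _).1.mul_const _]
    simp only [integral_mul_const, ← hTeq]
    congr 1
    exact Finset.sum_congr rfl fun κ _ => by rw [← hσT, mul_comm]
  rw [hnorm]
  calc ENNReal.ofReal (∫ y, f y * h y ∂(cubeMeasure d))
      ≤ ENNReal.ofReal ‖∫ y, f y * h y ∂(cubeMeasure d)‖ :=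
        ENNReal.ofReal_le_ofReal (le_abs_self _)
    _ = ‖∫ y, f y * h y ∂(cubeMeasure d)‖ₑ := ofReal_norm _
    _ ≤ ∫⁻ y, ‖f y * h y‖ₑ ∂(cubeMeasure d) := enorm_integral_le_lintegral_enorm _
    _ = ∫⁻ y, ENNReal.ofReal (|f y| * |h y|) ∂(cubeMeasure d) := by
        simp only [← ofReal_norm, norm_mul, Real.norm_eq_abs]
    _ ≤ C * (1 + X) := hdual d B.card (cubeMeasure d) f h hfm hhm hpow
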